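/- Let $d\ge 0$ and let $D\subset\mathbb{R}^d$ be a non-empty Borel set whose affine hull is $\mathbb{R}^d$. Let $\widehat D=D\cup\{\delta\}$ carry the $\sigma$-algebra generated by the Borel subsets of $D$ and $\{\delta\}$, and the Alexandrov topology (the open subsets of $D$ are open, and $U\cup\{\delta\}$ is open for every open $U\subset D$ with compact complement in $D$). On a measurable space with a right-continuous filtration $(\mathcal F_t)_{t\ge0}$ and probability measures $(\mathbb P^x)_{x\in\widehat D}$, let $X$ be an adapted $\widehat D$-valued process whose paths are almost surely, under every $\mathbb P^x$, càdlàg for the topology of $\widehat D$. Suppose that $p_t(x,A)=\mathbb P^x(X_t\in A)$ is measurable in $x$, that $p_0(x,\{x\})=1$, that the Chapman--Kolmogorov equation holds, that $X$ has the Markov property $\mathbb P^x(X_{s+t}\in A\mid\mathcal F_s)=p_t(X_s,A)$, and that $\delta$ is absorbing ($p_t(\delta,\{\delta\})=1$, and almost surely a path that has reached $\delta$ stays there). With $\langle u,x\rangle=\sum_i u_ix_i$ for $u\in\mathbb{C}^d$, $x\in\mathbb{R}^d$, put $$\mathcal U=\Big\{u\in\mathbb C^d:\sup_{x\in D}\operatorname{Re}\langle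 u,x\rangle<\infty\Big\},\qquad \mathcal U_k=\Big\{u\in\mathbb C^d:\sup_{x\in D}\operatorname{Re}\langle u,x\rangle\le k\Big\}\quad(k\in\mathbb N).$$ Suppose that $X$ is affine: for all $t\ge0$ and $x\in D$ the measures $p_s(x,\cdot)$ converge to $p_t(x,\cdot)$ weakly on $D$ as $s\to t$, and there are functions $\Phi:\mathbb R_{\ge0}\times\mathcal U\to\mathbb C$ and $\psi_0:\mathbb R_{\ge0}\times\mathcal U\to\mathbb C^d$ with $$\int_D e^{\langle u,\xi\rangle}\,p_t(x,d\xi)=\Phi(t,u)\,e^{\langle\psi_0(t,u),x\rangle}\qquad(t\ge0,\ x\in D,\ u\in\mathcal U).$$ Let $\sigma(u)=\inf\{t\ge0:\Phi(t,u)=0\}\in[0,\infty]$, $\mathcal Q_k=\{(t,u):u\in\mathcal U_k,\ 0\le t<\sigma(u)\}$ and $\mathcal Q=\bigcup_k\mathcal Q_k$. Then $X$ is regular. That is: $\sigma(u)>0$ for all $u\in\mathcal U$; there are functions $\phi:\mathcal Q\to\mathbb C$ and $\psi:\mathcal Q\to\mathbb C^d$, and they are unique, which are continuous on $\mathcal Q_k$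 for each $k$, satisfy $\phi(0,0)=0$ and $\psi(0,0)=0$, and satisfy $$\int_D e^{\langle u,\xi\rangle}\,p_t(x,d\xi)=e^{\phi(t,u)+\langle\psi(t,u),x\rangle}\qquad((t,u)\in\mathcal Q,\ x\in D);$$ and the right derivatives $$F(u)=\frac{\partial\phi(t,u)}{\partial t}\Big|_{t=0+},\qquad R(u)=\frac{\partial\psi(t,u)}{\partial t}\Big|_{t=0+}$$ exist for all $u\in\mathcal U$ and are continuous on $\mathcal U_k$ for each $k\in\mathbb N$. -/

import Mathlib

open MeasureTheory ProbabilityTheory Filter Topology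
open scoped NNReal ENNReal

noncomputable section

/-- The state space `D̂ = D ∪ {δ}` is Mathlib's `OnePoint D`, with `δ = ∞` and with its Alexandrov
topology.  It carries the σ-algebra generated by the measurable subsets of `D` and by `{δ}`: a set
is measurable iff its trace on `D` is. -/
instance OnePoint.instMeasurableSpaceOfPoint {E : Type*} [MeasurableSpace E] :
    MeasurableSpace (OnePoint E) :=
  MeasurableSpace.map (fun x : E => (x : OnePoint E)) inferInstance

namespace AffineProcess

/-- The bilinear (not sesquilinear) extension `⟨u, x⟩ = ∑ i, u i * x i` of the inner product. -/
def pair {d : ℕ} (u : EuclideanSpace ℂ (Fin d)) (x : EuclideanSpace ℝ (Fin d)) : ℂ :=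
  ∑ i, u i * (x i : ℂ)

/-- The set `𝒰` of all `u` for which `x ↦ exp ⟨u, x⟩` is bounded on `D`. -/
def cU {d : ℕ} (D : Set (EuclideanSpace ℝ (Fin d))) : Set (EuclideanSpace ℂ (Fin d)) :=
  {u | BddAbove ((fun x => (pair u x).re) '' D)}

/-- The set `𝒰_k` of all `u` with `sup_{x ∈ D} Re ⟨u, x⟩ ≤ k`. -/
def cUk {d : ℕ} (D : Set (EuclideanSpace ℝ (Fin d))) (k : ℕ) : Set (EuclideanSpace ℂ (Fin d)) :=
  {u | ∀ x ∈ D, (pair u x).re ≤ k}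

/-- Extension of a function on `D` to `D̂` by the value `0` at the cemetery state. -/
def extendZero {E F : Type*} [Zero F] (f : E → F) (y : OnePoint E) : F :=
  y.elim 0 f

section Definitions

variable {d : ℕ} {D : Set (EuclideanSpace ℝ (Fin d))} {Ω : Type*} [mΩ : MeasurableSpace Ω]

/-- The transition kernel `p_t(x, A) = ℙ^x (X_t ∈ A)`, as a measure on `D̂`. -/
def transition (P : OnePoint D → Measure Ω) (X : ℝ≥0 → Ω → OnePoint D) (t : ℝ≥0) (x : OnePoint D) :
    Measure (OnePoint D) :=
  (P x).map (X t)

/-- `X` is, with respect to the filtration `𝔽` and the family `(ℙ^x)`, a time-homogeneous Markov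
process with values in `D̂`, with a normal transition kernel and with absorbing cemetery state `δ = OnePoint.infty`: `p_t(δ, {δ}) = 1`,
and a path that has reached `δ` stays there. -/
structure IsMarkovProcess (𝔽 : Filtration ℝ≥0 mΩ) (P : OnePoint D → Measure Ω)
    (X : ℝ≥0 → Ω → OnePoint D) : Prop where
  isProbabilityMeasure : ∀ x, IsProbabilityMeasure (P x)
  adapted : ∀ t, Measurable[𝔽 t] (X t)
  measurable_trans : ∀ t, ∀ A : Set (OnePoint D), MeasurableSet A →
    Measurable fun x => transition P X t x A
  normal : ∀ x, transition P X 0 x {x} = 1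
  trans_absorbing : ∀ t, transition P X t OnePoint.infty {OnePoint.infty} = 1
  chapmanKolmogorov : ∀ s t x, ∀ A : Set (OnePoint D), MeasurableSet A →
    transition P X (t + s) x A = ∫⁻ y, transition P X t y A ∂(transition P X s x)
  markov : ∀ x s t, ∀ A : Set (OnePoint D), MeasurableSet A →
    (P x)⟦X (s + t) ⁻¹' A | 𝔽 s⟧ =ᵐ[P x] fun ω => (transition P X t (X s ω) A).toReal
  path_absorbing : ∀ x, ∀ᵐ ω ∂(P x), ∀ s t, s ≤ t → X s ω = OnePoint.infty → X t ω = OnePoint.infty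

/-- Almost surely under every `ℙ^x`, the path of `X` is right-continuous with left limits, in the
Alexandrov topology of `D̂`. -/
def IsCadlag (P : OnePoint D → Measure Ω) (X : ℝ≥0 → Ω → OnePoint D) : Prop :=
  ∀ x, ∀ᵐ ω ∂(P x), ∀ t,
    ContinuousWithinAt (fun s => X s ω) (Set.Ici t) t ∧
      ∃ l, Tendsto (fun s => X s ω) (𝓝[<] t) (𝓝 l)

/-- Stochastic continuity: `p_s(x, ·) → p_t(x, ·)` weakly on `D` as `s → t`. -/
def IsStochasticallyContinuous (P : OnePoint D → Measure Ω) (X : ℝ≥0 → Ω → OnePoint D) : Prop :=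
  ∀ (t : ℝ≥0) (x : D) (f : BoundedContinuousFunction D ℝ),
    Tendsto (fun s => ∫ y, extendZero f y ∂(transition P X s x)) (𝓝 t)
      (𝓝 (∫ y, extendZero f y ∂(transition P X t x)))

/-- The Fourier-Laplace transform `∫_D exp ⟨u, ξ⟩ p_t(x, dξ)`. -/
def fourierLaplace (P : OnePoint D → Measure Ω) (X : ℝ≥0 → Ω → OnePoint D)
    (t : ℝ≥0) (x : D) (u : EuclideanSpace ℂ (Fin d)) : ℂ :=
  ∫ y, extendZero (fun ξ : D => Complex.exp (pair u ξ)) y ∂(transition P X t x)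

/-- `X` is affine, and `Φ`, `ψ` are functions that witness the affine property. -/
structure IsAffine (P : OnePoint D → Measure Ω) (X : ℝ≥0 → Ω → OnePoint D)
    (Φ : ℝ≥0 → EuclideanSpace ℂ (Fin d) → ℂ)
    (ψ : ℝ≥0 → EuclideanSpace ℂ (Fin d) → EuclideanSpace ℂ (Fin d)) : Prop where
  stochasticallyContinuous : IsStochasticallyContinuous P X
  affine : ∀ (t : ℝ≥0) (x : D), ∀ u ∈ cU D,
    fourierLaplace P X t x u = Φ t u * Complex.exp (pair (ψ t u) x)

/-- `σ(u) = inf {t ≥ 0 : Φ(t, u) = 0}`, which is `∞` if `Φ(·, u)` has no zero. -/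
def lifetime (Φ : ℝ≥0 → EuclideanSpace ℂ (Fin d) → ℂ) (u : EuclideanSpace ℂ (Fin d)) : ℝ≥0∞ :=
  ⨅ (t : ℝ≥0) (_ : Φ t u = 0), (t : ℝ≥0∞)

/-- `𝒬_k = {(t, u) : u ∈ 𝒰_k, t < σ(u)}`. -/
def cQk (D : Set (EuclideanSpace ℝ (Fin d))) (Φ : ℝ≥0 → EuclideanSpace ℂ (Fin d) → ℂ) (k : ℕ) :
    Set (ℝ≥0 × EuclideanSpace ℂ (Fin d)) :=
  {q | q.2 ∈ cUk D k ∧ (q.1 : ℝ≥0∞) < lifetime Φ q.2}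

/-- `𝒬` is the union of the sets `𝒬_k`. -/
def cQ (D : Set (EuclideanSpace ℝ (Fin d))) (Φ : ℝ≥0 → EuclideanSpace ℂ (Fin d) → ℂ) :
    Set (ℝ≥0 × EuclideanSpace ℂ (Fin d)) :=
  ⋃ k, cQk D Φ k

/-- `(φ, ψ)` is the normalized choice of exponents: on `𝒬` the Fourier-Laplace transform is
`exp (φ(t, u) + ⟨ψ(t, u), x⟩)`, the functions `φ` and `ψ` are jointly continuous on every `𝒬_k`,
and they vanish at `(0, 0)`. -/
structure IsNormalized (P : OnePoint D → Measure Ω) (X : ℝ≥0 → Ω → OnePoint D)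
    (Φ : ℝ≥0 → EuclideanSpace ℂ (Fin d) → ℂ)
    (φ : ℝ≥0 → EuclideanSpace ℂ (Fin d) → ℂ)
    (ψ : ℝ≥0 → EuclideanSpace ℂ (Fin d) → EuclideanSpace ℂ (Fin d)) : Prop where
  eq_exp : ∀ t u, (t, u) ∈ cQ D Φ → ∀ x : D,
    fourierLaplace P X t x u = Complex.exp (φ t u + pair (ψ t u) x)
  continuousOn_phi : ∀ k, ContinuousOn (fun q : ℝ≥0 × EuclideanSpace ℂ (Fin d) => φ q.1 q.2)
    (cQk D Φ k)
  continuousOn_psi : ∀ k, ContinuousOn (fun q : ℝ≥0 × EuclideanSpace ℂ (Fin d) => ψ q.1 q.2)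
    (cQk D Φ k)
  phi_zero : φ 0 0 = 0
  psi_zero : ψ 0 0 = 0

/-- The function `f` of `t ≥ 0` has the right derivative `f'` at `t = 0`. -/
def HasRightDerivAtZero {E : Type*} [NormedAddCommGroup E] [NormedSpace ℝ E]
    (f : ℝ≥0 → E) (f' : E) : Prop :=
  HasDerivWithinAt (fun t : ℝ => f t.toNNReal) f' (Set.Ici 0) 0

/-- Regularity of an affine process.  `σ(u) > 0` for all `u ∈ 𝒰`, the normalized exponents `φ` and
`ψ` exist and are unique on `𝒬`, and their right derivatives `F(u)` and `R(u)` at `t = 0` exist for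
all `u ∈ 𝒰` and are continuous on every `𝒰_k`. -/
def IsRegular (P : OnePoint D → Measure Ω) (X : ℝ≥0 → Ω → OnePoint D)
    (Φ : ℝ≥0 → EuclideanSpace ℂ (Fin d) → ℂ) : Prop :=
  (∀ u ∈ cU D, 0 < lifetime Φ u) ∧
  ∃ (φ : ℝ≥0 → EuclideanSpace ℂ (Fin d) → ℂ)
    (ψ : ℝ≥0 → EuclideanSpace ℂ (Fin d) → EuclideanSpace ℂ (Fin d)),
    IsNormalized P X Φ φ ψ ∧
    (∀ φ' ψ', IsNormalized P X Φ φ' ψ' →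
      ∀ t u, (t, u) ∈ cQ D Φ → φ' t u = φ t u ∧ ψ' t u = ψ t u) ∧
    ∃ (F : EuclideanSpace ℂ (Fin d) → ℂ)
      (R : EuclideanSpace ℂ (Fin d) → EuclideanSpace ℂ (Fin d)),
      (∀ u ∈ cU D, HasRightDerivAtZero (fun t => φ t u) (F u) ∧
        HasRightDerivAtZero (fun t => ψ t u) (R u)) ∧
      ∀ k, ContinuousOn F (cUk D k) ∧ ContinuousOn R (cUk D k)

end Definitions

end AffineProcess

end

/-!
Write `w(t, u) = (φ(t, u), ψ(t, u) - u)` for the increment of the exponents and, for `w = (a, b)`,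
`affineEval w x = a + ⟨b, x⟩`, so that `P_t e^{⟨u, ·⟩} - e^{⟨u, ·⟩} = e^{⟨u, ·⟩} (e^{affineEval w} - 1)`.

*Exponents.*  Stochastic continuity makes the Fourier–Laplace transform jointly continuous on
`ℝ≥0 × 𝒰_k` (`continuousOn_fourierLaplace`), hence zero-free for small times.  For each `x ∈ D` and
`(t, u) ∈ 𝒬` the path `s ↦ ∫ e^{⟨u, ξ⟩} p_{st}(x, dξ)` has a continuous logarithm that starts at
`⟨u, x⟩`.  By the affine property these logarithms are affine in `x` modulo a countable set, so by
connectedness they are affine in `x`, and interpolation at an affine basis of points of `D` gives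
`φ` and `ψ` (`exists_normalized`).  Uniqueness is the same connectedness argument.

*Derivatives.*  Fix `x ∈ D` and `u₀ ∈ 𝒰_k`, start the process at `x`, and stop it on the grid `tℕ` at
the first exit from a small ball around `x`, or at a small fixed time `T` if that comes first.  Up to
this time each step of the grid changes the expectation of `e^{⟨u, X⟩}` by approximately
`e^{⟨u₀, x⟩} affineEval (w(t, u)) x`, with an error that is small relative to the size of `w(t, u)`;
there are about `T / t` steps, and an early exit is improbable (`dynkin_estimate`).  As `t → 0` and
`u → u₀`, the grid exit times decrease to the true exit time, so by right-continuity the stopped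
expectation converges to a number that does not depend on how the limit is taken.  Therefore
`affineEval (w(t, u) / t) x` is eventually constant up to a small error relative to `w(t, u) / t`
(`exists_eventually_norm_affineEval_quotient_sub_le`).  Finitely many points `x` determine an affine
function, and so the quotients `w(t, u) / t` are first bounded and then Cauchy.  They converge
jointly in `(t, u)`, which yields both the right derivatives `F`, `R` and their continuity on `𝒰_k`.
-/

namespace AffineProcess

/-! ### Complex affine functions on `ℝ^d` -/

section Linear

variable {d : ℕ}

lemma pair_sub_left (u v : EuclideanSpace ℂ (Fin d)) (x : EuclideanSpace ℝ (Fin d)) :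
    pair (u - v) x = pair u x - pair v x := by
  simp [pair, sub_mul, Finset.sum_sub_distrib]

lemma pair_smul_left (c : ℂ) (u : EuclideanSpace ℂ (Fin d)) (x : EuclideanSpace ℝ (Fin d)) :
    pair (c • u) x = c * pair u x := by
  simp [pair, Finset.mul_sum, mul_assoc]

lemma pair_zero_left (x : EuclideanSpace ℝ (Fin d)) : pair 0 x = 0 := by
  simp [pair]

lemma pair_sub_right (u : EuclideanSpace ℂ (Fin d)) (x y : EuclideanSpace ℝ (Fin d)) :
    pair u (x - y) = pair u x - pair u y := by
  simp [pair, mul_sub, Finset.sum_sub_distrib]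

lemma continuous_pair :
    Continuous fun p : EuclideanSpace ℂ (Fin d) × EuclideanSpace ℝ (Fin d) => pair p.1 p.2 := by
  unfold pair
  fun_prop

lemma norm_pair_le (u : EuclideanSpace ℂ (Fin d)) (x : EuclideanSpace ℝ (Fin d)) :
    ‖pair u x‖ ≤ ‖u‖ * ‖x‖ := by
  calc ‖pair u x‖ ≤ ∑ i, ‖u i‖ * ‖x i‖ := by
        refine (norm_sum_le _ _).trans (le_of_eq ?_)
        simp
    _ ≤ √(∑ i, ‖u i‖ ^ 2) * √(∑ i, ‖x i‖ ^ 2) := Real.sum_mul_le_sqrt_mul_sqrt _ _ _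
    _ = ‖u‖ * ‖x‖ := by rw [EuclideanSpace.norm_eq, EuclideanSpace.norm_eq]

/-- The value at `x` of the complex affine function `x ↦ a + ⟨b, x⟩` with coefficients
`w = (a, b)`. -/
noncomputable def affineEval (w : ℂ × EuclideanSpace ℂ (Fin d)) (x : EuclideanSpace ℝ (Fin d)) :
    ℂ :=
  w.1 + pair w.2 x

lemma affineEval_sub (v w : ℂ × EuclideanSpace ℂ (Fin d)) (x : EuclideanSpace ℝ (Fin d)) :
    affineEval (v - w) x = affineEval v x - affineEval w x := by
  simp only [affineEval, Prod.fst_sub, Prod.snd_sub, pair_sub_left]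
  ring

lemma affineEval_smul (c : ℂ) (w : ℂ × EuclideanSpace ℂ (Fin d)) (x : EuclideanSpace ℝ (Fin d)) :
    affineEval (c • w) x = c * affineEval w x := by
  simp only [affineEval, Prod.smul_fst, Prod.smul_snd, pair_smul_left, smul_eq_mul]
  ring

lemma norm_affineEval_le (w : ℂ × EuclideanSpace ℂ (Fin d)) (x : EuclideanSpace ℝ (Fin d)) :
    ‖affineEval w x‖ ≤ ‖w‖ * (1 + ‖x‖) := by
  have h1 : ‖w.1‖ ≤ ‖w‖ := norm_fst_le w
  have h2 : ‖w.2‖ * ‖x‖ ≤ ‖w‖ * ‖x‖ := by gcongr; exact norm_snd_le w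
  calc ‖affineEval w x‖ ≤ ‖w.1‖ + ‖pair w.2 x‖ := norm_add_le _ _
    _ ≤ ‖w.1‖ + ‖w.2‖ * ‖x‖ := by gcongr; exact norm_pair_le _ _
    _ ≤ ‖w‖ * (1 + ‖x‖) := by linarith

lemma norm_affineEval_sub_le (w : ℂ × EuclideanSpace ℂ (Fin d)) (x y : EuclideanSpace ℝ (Fin d)) :
    ‖affineEval w x - affineEval w y‖ ≤ ‖w‖ * ‖x - y‖ := by
  have h : affineEval w x - affineEval w y = pair w.2 (x - y) := by
    simp only [affineEval, pair_sub_right]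
    ring
  rw [h]
  refine (norm_pair_le _ _).trans ?_
  gcongr
  exact norm_snd_le w

lemma continuous_affineEval_left (x : EuclideanSpace ℝ (Fin d)) :
    Continuous fun w : ℂ × EuclideanSpace ℂ (Fin d) => affineEval w x :=
  continuous_fst.add (continuous_pair.comp (continuous_snd.prodMk continuous_const))

lemma affineEval_injective {v w : ℂ × EuclideanSpace ℂ (Fin d)}
    (h : ∀ x, affineEval v x = affineEval w x) : v = w := by
  have h0 : v.1 = w.1 := by simpa [affineEval, pair] using h 0
  refine Prod.ext h0 ?_
  ext j
  have := h (EuclideanSpace.single j 1)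
  simpa [affineEval, pair, h0, Pi.single_apply, apply_ite] using this

/-- An affine function is reconstructed linearly from its values at finitely many points of a set
that spans the space affinely: `L` interpolates, and `c i` are the barycentric coordinates. -/
lemma exists_interpolation {D : Set (EuclideanSpace ℝ (Fin d))} (hD : affineSpan ℝ D = ⊤) :
    ∃ (ι : Type) (_ : Fintype ι) (p : ι → D) (c : ι → EuclideanSpace ℝ (Fin d) → ℝ)
      (L : (ι → ℂ) →L[ℂ] ℂ × EuclideanSpace ℂ (Fin d)),
      (∀ w, L (fun i => affineEval w (p i)) = w) ∧
      ∀ h y, affineEval (L h) y = ∑ i, (c i y : ℂ) * h i := by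
  obtain ⟨s, hsD, b, hb⟩ := AffineBasis.exists_affine_subbasis hD
  have hfin : Finite s := finite_of_fin_dim_affineIndependent ℝ b.ind
  obtain ⟨n, ⟨e⟩⟩ := Finite.exists_equiv_fin s
  let b' : AffineBasis (Fin n) ℝ (EuclideanSpace ℝ (Fin d)) := b.reindex e
  have hp : ∀ i, b' i ∈ D := fun i => by
    have : b' i = ((e.symm i : s) : EuclideanSpace ℝ (Fin d)) := by
      simp [b', hb]
    rw [this]
    exact hsD (e.symm i).2
  let a : Fin n → EuclideanSpace ℝ (Fin d) →ₗ[ℝ] ℝ := fun i => (b'.coord i).linear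
  have ha : ∀ i y, b'.coord i y = b'.coord i 0 + ∑ j, y j * a i (EuclideanSpace.single j 1) := by
    intro i y
    have h1 : b'.coord i y = a i y + b'.coord i 0 := by
      have := (b'.coord i).map_vadd 0 y
      rwa [vadd_eq_add, add_zero, vadd_eq_add] at this
    have h2 : y = ∑ j, y j • (EuclideanSpace.single j (1 : ℝ) : EuclideanSpace ℝ (Fin d)) := by
      ext k
      simp [Pi.single_apply]
    rw [h1, add_comm]
    conv_lhs => rw [h2]
    simp
  let L : (Fin n → ℂ) →ₗ[ℂ] ℂ × EuclideanSpace ℂ (Fin d) :=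
    { toFun := fun h => (∑ i, (b'.coord i 0 : ℂ) * h i,
        WithLp.toLp 2 fun j => ∑ i, (a i (EuclideanSpace.single j 1) : ℂ) * h i)
      map_add' := by
        intro h k
        ext <;> simp [mul_add, Finset.sum_add_distrib]
      map_smul' := by
        intro r h
        ext <;> simp [Finset.mul_sum, mul_left_comm] }
  have hL : ∀ h y, affineEval (L h) y = ∑ i, (b'.coord i y : ℂ) * h i := by
    intro h y
    simp only [affineEval, pair, L, LinearMap.coe_mk, AddHom.coe_mk]
    simp_rw [ha _ y, Finset.sum_mul]
    rw [Finset.sum_comm, ← Finset.sum_add_distrib]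
    refine Finset.sum_congr rfl fun i _ => ?_
    push_cast
    rw [add_mul, Finset.sum_mul]
    congr 1
    exact Finset.sum_congr rfl fun j _ => by ring
  refine ⟨Fin n, inferInstance, fun i => ⟨b' i, hp i⟩, fun i y => b'.coord i y,
    LinearMap.toContinuousLinearMap L, fun w => affineEval_injective fun y => ?_, hL⟩
  refine (hL _ y).trans ?_
  have h1 : ∑ i, (b'.coord i y : ℂ) = 1 := by
    exact_mod_cast congrArg (fun r : ℝ => (r : ℂ)) (b'.sum_coord_apply_eq_one y)
  have h2 : ∀ j, ∑ i, (b'.coord i y : ℂ) * (b' i j : ℂ) = y j := by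
    intro j
    have := congrArg (fun v : EuclideanSpace ℝ (Fin d) => ((v j : ℝ) : ℂ))
      (b'.linear_combination_coord_eq_self y)
    simpa [-AffineBasis.linear_combination_coord_eq_self] using this
  simp only [affineEval, pair, mul_add, Finset.sum_add_distrib, ← Finset.sum_mul, h1, one_mul]
  congr 1
  simp_rw [Finset.mul_sum]
  rw [Finset.sum_comm]
  refine Finset.sum_congr rfl fun j _ => ?_
  rw [← h2 j, Finset.mul_sum]
  exact Finset.sum_congr rfl fun i _ => by ring

end Linear

/-! ### Continuity of the Fourier–Laplace transform -/

section Transform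

variable {d : ℕ} {D : Set (EuclideanSpace ℝ (Fin d))} {Ω : Type*} [mΩ : MeasurableSpace Ω]

/-- The exponential `e^{⟨u, ·⟩}` on `D̂`, with the value `0` at the cemetery state. -/
noncomputable def expPair (u : EuclideanSpace ℂ (Fin d)) : OnePoint D → ℂ :=
  extendZero fun ξ : D => Complex.exp (pair u ξ)

lemma expPair_coe (u : EuclideanSpace ℂ (Fin d)) (x : D) :
    expPair u (x : OnePoint D) = Complex.exp (pair u x) := rfl

lemma expPair_infty (u : EuclideanSpace ℂ (Fin d)) :
    expPair u (OnePoint.infty : OnePoint D) = 0 := rfl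

lemma measurable_extendZero {F : Type*} [Zero F] [MeasurableSpace F] {f : D → F}
    (hf : Measurable f) : Measurable (extendZero f) := fun _ hs => hf hs

lemma measurableSet_singleton_coe (x : D) :
    MeasurableSet ({(x : OnePoint D)} : Set (OnePoint D)) := by
  change MeasurableSet ((fun z : D => (z : OnePoint D)) ⁻¹' {(x : OnePoint D)})
  convert measurableSet_singleton x
  ext z
  simp

lemma measurable_expPair (u : EuclideanSpace ℂ (Fin d)) :
    Measurable (expPair u : OnePoint D → ℂ) := by
  refine measurable_extendZero (Continuous.measurable ?_)
  exact Complex.continuous_exp.comp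
    (continuous_pair.comp (continuous_const.prodMk continuous_subtype_val))

lemma norm_expPair_le {k : ℕ} {u : EuclideanSpace ℂ (Fin d)} (hu : u ∈ cUk D k)
    (y : OnePoint D) : ‖expPair u y‖ ≤ Real.exp k := by
  induction y using OnePoint.rec with
  | infty => rw [expPair_infty, norm_zero]; positivity
  | coe x =>
    rw [expPair_coe, Complex.norm_exp]
    exact Real.exp_le_exp.2 (hu x x.2)

lemma zero_mem_cUk (k : ℕ) : (0 : EuclideanSpace ℂ (Fin d)) ∈ cUk D k := fun x _ => by
  simp [pair_zero_left]

lemma smul_mem_cUk {k : ℕ} {u : EuclideanSpace ℂ (Fin d)} (hu : u ∈ cUk D k) {s : ℝ}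
    (hs0 : 0 ≤ s) (hs1 : s ≤ 1) : (s : ℂ) • u ∈ cUk D k := fun x hx => by
  rw [pair_smul_left, Complex.re_ofReal_mul]
  have h1 : s * (pair u x).re ≤ s * k := mul_le_mul_of_nonneg_left (hu x hx) hs0
  have h2 : s * k ≤ k := mul_le_of_le_one_left k.cast_nonneg hs1
  exact h1.trans h2

lemma cUk_subset_cU (k : ℕ) : cUk D k ⊆ cU D := fun u hu => ⟨k, by
  rintro _ ⟨x, hx, rfl⟩
  exact hu x hx⟩

lemma exists_mem_cUk {u : EuclideanSpace ℂ (Fin d)} (hu : u ∈ cU D) : ∃ k, u ∈ cUk D k := by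
  obtain ⟨C, hC⟩ := hu
  obtain ⟨k, hk⟩ := exists_nat_ge C
  exact ⟨k, fun x hx => (hC ⟨x, hx, rfl⟩).trans hk⟩

lemma norm_exp_sub_exp_le {c : ℝ} {a b : ℂ} (ha : a.re ≤ c) (hb : b.re ≤ c) :
    ‖Complex.exp a - Complex.exp b‖ ≤ Real.exp c * ‖a - b‖ := by
  refine Convex.norm_image_sub_le_of_norm_hasDerivWithin_le (f' := Complex.exp)
    (s := {z : ℂ | z.re ≤ c}) (fun z _ => (Complex.hasDerivAt_exp z).hasDerivWithinAt)
    (fun z hz => ?_) (convex_halfSpace_re_le c) hb ha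
  rw [Complex.norm_exp]
  exact Real.exp_le_exp.2 hz

variable {𝔽 : Filtration ℝ≥0 mΩ} {P : OnePoint D → Measure Ω} {X : ℝ≥0 → Ω → OnePoint D}

lemma IsMarkovProcess.measurable (hM : IsMarkovProcess 𝔽 P X) (t : ℝ≥0) : Measurable (X t) :=
  (hM.adapted t).mono (𝔽.le t) le_rfl

lemma IsMarkovProcess.isProbabilityMeasure_transition (hM : IsMarkovProcess 𝔽 P X) (t : ℝ≥0)
    (x : OnePoint D) : IsProbabilityMeasure (transition P X t x) :=
  have := hM.isProbabilityMeasure x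
  Measure.isProbabilityMeasure_map (hM.measurable t).aemeasurable

lemma integrable_of_measurable_of_norm_le {α : Type*} [MeasurableSpace α] {μ : Measure α}
    [IsFiniteMeasure μ] {f : α → ℂ} (hf : Measurable f) {C : ℝ} (hC : ∀ a, ‖f a‖ ≤ C) :
    Integrable f μ :=
  Integrable.of_bound hf.aestronglyMeasurable C (ae_of_all _ hC)

lemma IsMarkovProcess.fourierLaplace_zero (hM : IsMarkovProcess 𝔽 P X) (x : D)
    (u : EuclideanSpace ℂ (Fin d)) : fourierLaplace P X 0 x u = Complex.exp (pair u x) := by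
  have := hM.isProbabilityMeasure_transition 0 (x : OnePoint D)
  have hx : ∀ᵐ y ∂(transition P X 0 (x : OnePoint D)), y = (x : OnePoint D) := by
    have := (prob_compl_eq_zero_iff (measurableSet_singleton_coe x)).2 (hM.normal x)
    rwa [ae_iff]
  unfold fourierLaplace
  rw [integral_congr_ae (g := fun _ => Complex.exp (pair u x))
    (hx.mono fun y hy => by subst hy; rfl)]
  simp

/-- Stochastic continuity extends to the complex exponentials. -/
lemma tendsto_fourierLaplace (hM : IsMarkovProcess 𝔽 P X)
    (hS : IsStochasticallyContinuous P X) {k : ℕ} {u : EuclideanSpace ℂ (Fin d)}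
    (hu : u ∈ cUk D k) (x : D) (t : ℝ≥0) :
    Tendsto (fun s => fourierLaplace P X s x u) (𝓝 t) (𝓝 (fourierLaplace P X t x u)) := by
  have hcont : Continuous fun ξ : D => Complex.exp (pair u ξ) := Complex.continuous_exp.comp
    (continuous_pair.comp (continuous_const.prodMk continuous_subtype_val))
  have hbd : ∀ ξ : D, ‖Complex.exp (pair u ξ)‖ ≤ Real.exp k := fun ξ =>
    norm_expPair_le hu (ξ : OnePoint D)
  let f : BoundedContinuousFunction D ℝ := BoundedContinuousFunction.ofNormedAddCommGroup
    (fun ξ : D => (Complex.exp (pair u ξ)).re) (Complex.continuous_re.comp hcont) (Real.exp k)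
    fun ξ => (Complex.abs_re_le_norm _).trans (hbd ξ)
  let g : BoundedContinuousFunction D ℝ := BoundedContinuousFunction.ofNormedAddCommGroup
    (fun ξ : D => (Complex.exp (pair u ξ)).im) (Complex.continuous_im.comp hcont) (Real.exp k)
    fun ξ => (Complex.abs_im_le_norm _).trans (hbd ξ)
  have hf : ∀ y, extendZero f y = RCLike.re (expPair u y : ℂ) := fun y => by
    induction y using OnePoint.rec <;> rfl
  have hg : ∀ y, extendZero g y = RCLike.im (expPair u y : ℂ) := fun y => by
    induction y using OnePoint.rec <;> rfl
  have key : ∀ s, fourierLaplace P X s x u =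
      ((∫ y, extendZero f y ∂(transition P X s x) : ℝ) : ℂ) +
        ((∫ y, extendZero g y ∂(transition P X s x) : ℝ) : ℂ) * Complex.I := fun s => by
    have := hM.isProbabilityMeasure_transition s (x : OnePoint D)
    simp_rw [hf, hg]
    exact (integral_re_add_im (integrable_of_measurable_of_norm_le (measurable_expPair u)
      (norm_expPair_le hu))).symm
  simp_rw [key]
  exact ((Complex.continuous_ofReal.tendsto _).comp (hS t x f)).add
    (((Complex.continuous_ofReal.tendsto _).comp (hS t x g)).mul_const _)

/-- The Fourier–Laplace transform is jointly continuous in time and in the transform variable.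
The modulus of continuity in `u` is controlled by integrals of the bounded continuous functions
`ξ ↦ min 2 (ρ ‖ξ‖)`, which pass to the limit in time. -/
lemma continuousOn_fourierLaplace (hM : IsMarkovProcess 𝔽 P X)
    (hS : IsStochasticallyContinuous P X) (k : ℕ) (x : D) :
    ContinuousOn (fun q : ℝ≥0 × EuclideanSpace ℂ (Fin d) => fourierLaplace P X q.1 x q.2)
      (Set.univ ×ˢ cUk D k) := by
  rintro ⟨t, u⟩ ⟨-, hu⟩
  change u ∈ cUk D k at hu
  let m : ℝ → BoundedContinuousFunction D ℝ := fun ρ =>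
    BoundedContinuousFunction.ofNormedAddCommGroup
      (fun ξ : D => min 2 |ρ * ‖(ξ : EuclideanSpace ℝ (Fin d))‖|) (by fun_prop) 2 fun ξ => by
      rw [Real.norm_of_nonneg (le_min (by norm_num) (abs_nonneg _))]
      exact min_le_left _ _
  have hm_meas : ∀ ρ, Measurable (extendZero (m ρ)) := fun ρ =>
    measurable_extendZero (m ρ).continuous.measurable
  have hm_nonneg : ∀ ρ y, 0 ≤ extendZero (m ρ) y := fun ρ y => by
    induction y using OnePoint.rec with
    | infty => exact le_rfl
    | coe z => exact le_min (by norm_num) (abs_nonneg _)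
  have hm_le : ∀ ρ y, ‖extendZero (m ρ) y‖ ≤ 2 := fun ρ y => by
    rw [Real.norm_of_nonneg (hm_nonneg ρ y)]
    induction y using OnePoint.rec with
    | infty => exact zero_le_two
    | coe z => exact min_le_left _ _
  -- dominated convergence: the modulus is small under the limit measure
  have hm_lim : Tendsto (fun n : ℕ => ∫ y, extendZero (m (1 / ((n : ℝ) + 1))) y
      ∂(transition P X t x)) atTop (𝓝 0) := by
    have := hM.isProbabilityMeasure_transition t (x : OnePoint D)
    have h := tendsto_integral_of_dominated_convergence (μ := transition P X t (x : OnePoint D))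
      (F := fun (n : ℕ) y => extendZero (m (1 / ((n : ℝ) + 1))) y) (f := fun _ => (0 : ℝ))
      (fun _ => 2)
      (fun n => (hm_meas _).aestronglyMeasurable) (integrable_const _)
      (fun n => ae_of_all _ (hm_le _)) (ae_of_all _ fun y => ?_)
    · simpa using h
    · induction y using OnePoint.rec with
      | infty => exact tendsto_const_nhds
      | coe z =>
        have h1 : Tendsto (fun n : ℕ => min (2 : ℝ)
            |1 / ((n : ℝ) + 1) * ‖(z : EuclideanSpace ℝ (Fin d))‖|) atTop
            (𝓝 (min 2 |0 * ‖(z : EuclideanSpace ℝ (Fin d))‖|)) :=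
          tendsto_const_nhds.min ((tendsto_one_div_add_atTop_nhds_zero_nat.mul_const _).abs)
        rw [zero_mul, abs_zero, min_eq_right zero_le_two] at h1
        exact h1
  -- the modulus bounds the variation in the transform variable
  have hbound : ∀ ρ s v, v ∈ cUk D k → ‖v - u‖ ≤ ρ →
      ‖fourierLaplace P X s x v - fourierLaplace P X s x u‖ ≤
        Real.exp k * ∫ y, extendZero (m ρ) y ∂(transition P X s x) := by
    intro ρ s v hv hvu
    have := hM.isProbabilityMeasure_transition s (x : OnePoint D)
    have h1 : fourierLaplace P X s x v - fourierLaplace P X s x u =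
        ∫ y, (expPair v y - expPair u y) ∂(transition P X s x) :=
      (integral_sub (integrable_of_measurable_of_norm_le (measurable_expPair v)
        (norm_expPair_le hv)) (integrable_of_measurable_of_norm_le (measurable_expPair u)
        (norm_expPair_le hu))).symm
    rw [h1, ← integral_const_mul]
    refine norm_integral_le_of_norm_le ((Integrable.of_bound
      (hm_meas ρ).aestronglyMeasurable 2 (ae_of_all _ (hm_le ρ))).const_mul _)
      (ae_of_all _ fun y => ?_)
    induction y using OnePoint.rec with
    | infty => simp [expPair_infty, extendZero]
    | coe z =>
      have h2 : ‖expPair v (z : OnePoint D) - expPair u (z : OnePoint D)‖ ≤ Real.exp k * 2 := by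
        refine (norm_sub_le _ _).trans ?_
        linarith [norm_expPair_le hv (z : OnePoint D), norm_expPair_le hu (z : OnePoint D)]
      have h3 : ‖expPair v (z : OnePoint D) - expPair u (z : OnePoint D)‖ ≤
          Real.exp k * |ρ * ‖(z : EuclideanSpace ℝ (Fin d))‖| := by
        rw [expPair_coe, expPair_coe]
        refine (norm_exp_sub_exp_le (hv z z.2) (hu z z.2)).trans ?_
        rw [← pair_sub_left]
        refine mul_le_mul_of_nonneg_left ?_ (Real.exp_pos _).le
        refine (norm_pair_le _ _).trans ((mul_le_mul_of_nonneg_right hvu (norm_nonneg _)).trans ?_)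
        exact le_abs_self _
      change _ ≤ Real.exp k * min 2 |ρ * ‖(z : EuclideanSpace ℝ (Fin d))‖|
      rw [mul_min_of_nonneg _ _ (Real.exp_pos _).le]
      exact le_min h2 h3
  have hdiff : Tendsto (fun q : ℝ≥0 × EuclideanSpace ℂ (Fin d) =>
      fourierLaplace P X q.1 x q.2 - fourierLaplace P X q.1 x u)
      (𝓝[Set.univ ×ˢ cUk D k] (t, u)) (𝓝 0) := by
    rw [Metric.tendsto_nhds]
    intro ε hε
    have hε' : 0 < ε / Real.exp k := by positivity
    obtain ⟨n, hn⟩ := (hm_lim.eventually (gt_mem_nhds hε')).exists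
    have hev : ∀ᶠ s in 𝓝 t, ∫ y, extendZero (m (1 / ((n : ℝ) + 1))) y ∂(transition P X s x) <
        ε / Real.exp k := (hS t x _).eventually (gt_mem_nhds hn)
    have hu_ev : ∀ᶠ v in 𝓝[cUk D k] u, v ∈ cUk D k ∧ ‖v - u‖ ≤ 1 / ((n : ℝ) + 1) := by
      refine eventually_mem_nhdsWithin.and (mem_nhdsWithin_of_mem_nhds ?_)
      filter_upwards [Metric.closedBall_mem_nhds u (ε := 1 / ((n : ℝ) + 1)) (by positivity)]
        with v hv
      rwa [mem_closedBall_iff_norm] at hv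
    rw [nhdsWithin_prod_eq, nhdsWithin_univ]
    filter_upwards [hev.prod_mk hu_ev] with q hq
    rw [dist_zero_right]
    refine (hbound _ q.1 q.2 hq.2.1 hq.2.2).trans_lt ?_
    have := (lt_div_iff₀' (Real.exp_pos _)).1 hq.1
    exact this
  have hfst : Tendsto (fun q : ℝ≥0 × EuclideanSpace ℂ (Fin d) => fourierLaplace P X q.1 x u)
      (𝓝[Set.univ ×ˢ cUk D k] (t, u)) (𝓝 (fourierLaplace P X t x u)) :=
    (tendsto_fourierLaplace hM hS hu x t).comp
      ((continuous_fst.tendsto (t, u)).mono_left nhdsWithin_le_nhds)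
  have := hdiff.add hfst
  simpa [ContinuousWithinAt] using this

variable {Φ : ℝ≥0 → EuclideanSpace ℂ (Fin d) → ℂ}
  {Ψ : ℝ≥0 → EuclideanSpace ℂ (Fin d) → EuclideanSpace ℂ (Fin d)}

lemma IsAffine.fourierLaplace_ne_zero_iff (hA : IsAffine P X Φ Ψ) {u : EuclideanSpace ℂ (Fin d)}
    (hu : u ∈ cU D) (t : ℝ≥0) (x : D) : fourierLaplace P X t x u ≠ 0 ↔ Φ t u ≠ 0 := by
  simp [hA.affine t x u hu]

lemma ne_zero_of_lt_lifetime {t : ℝ≥0} {u : EuclideanSpace ℂ (Fin d)}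
    (h : (t : ℝ≥0∞) < lifetime Φ u) : Φ t u ≠ 0 := fun h0 =>
  absurd h (not_lt.2 (iInf₂_le t h0))

lemma IsAffine.fourierLaplace_ne_zero (hA : IsAffine P X Φ Ψ) {k : ℕ}
    {q : ℝ≥0 × EuclideanSpace ℂ (Fin d)} (hq : q ∈ cQk D Φ k) (x : D) :
    fourierLaplace P X q.1 x q.2 ≠ 0 :=
  (hA.fourierLaplace_ne_zero_iff (cUk_subset_cU k hq.1) _ _).2 (ne_zero_of_lt_lifetime hq.2)

lemma mem_cQk_of_le {k : ℕ} {s t : ℝ≥0} {u : EuclideanSpace ℂ (Fin d)} (h : (t, u) ∈ cQk D Φ k)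
    (hst : s ≤ t) : (s, u) ∈ cQk D Φ k :=
  ⟨h.1, lt_of_le_of_lt (by exact_mod_cast hst) h.2⟩

/-- Close to time `0` all pairs `(t, u)` with `u ∈ 𝒰_k` lie in `𝒬_k`. -/
lemma eventually_mem_cQk (hD : D.Nonempty) (hM : IsMarkovProcess 𝔽 P X) (hA : IsAffine P X Φ Ψ)
    {k : ℕ} {u : EuclideanSpace ℂ (Fin d)} (hu : u ∈ cUk D k) :
    ∀ᶠ q in 𝓝 (0 : ℝ≥0) ×ˢ 𝓝[cUk D k] u, q ∈ cQk D Φ k := by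
  obtain ⟨x, hx⟩ := hD
  have h0 : fourierLaplace P X 0 ⟨x, hx⟩ u ≠ 0 := by
    rw [hM.fourierLaplace_zero]
    exact Complex.exp_ne_zero _
  have hc := continuousOn_fourierLaplace hM hA.stochasticallyContinuous k ⟨x, hx⟩ (0, u)
    ⟨trivial, hu⟩
  have hev := hc.eventually_ne h0
  rw [nhdsWithin_prod_eq, nhdsWithin_univ] at hev
  obtain ⟨p, hp, r, hr, hpr⟩ := eventually_prod_iff.1 hev
  obtain ⟨ε, hε, hball⟩ := Metric.eventually_nhds_iff.1 hp
  refine eventually_prod_iff.2 ⟨fun t => t < ε.toNNReal, gt_mem_nhds (by simpa using hε), _,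
    hr.and eventually_mem_nhdsWithin, fun {t} ht {v} hv => ⟨hv.2, ?_⟩⟩
  refine lt_of_lt_of_le (ENNReal.coe_lt_coe.2 ht) (le_iInf₂ fun s hs => ?_)
  by_contra! hlt
  have hs' : (s : ℝ) < ε := (Real.lt_toNNReal_iff_coe_lt).1 (ENNReal.coe_lt_coe.1 hlt)
  refine (hA.fourierLaplace_ne_zero_iff (cUk_subset_cU k hv.2) s ⟨x, hx⟩).1
    (hpr (hball ?_) hv.1) hs
  rw [NNReal.dist_eq]
  simpa using hs'

lemma lifetime_pos (hD : D.Nonempty) (hM : IsMarkovProcess 𝔽 P X) (hA : IsAffine P X Φ Ψ)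
    {u : EuclideanSpace ℂ (Fin d)} (hu : u ∈ cU D) : 0 < lifetime Φ u := by
  obtain ⟨k, hk⟩ := exists_mem_cUk hu
  have h := eventually_mem_cQk hD hM hA hk
  rw [← nhdsWithin_univ, ← nhdsWithin_prod_eq] at h
  exact (h.self_of_nhdsWithin (x := ((0 : ℝ≥0), u)) ⟨trivial, hk⟩).2

end Transform

/-! ### Continuous logarithms -/

section Logarithm

open unitInterval

/-- A continuous function on the unit interval with countable range that starts at `0`
vanishes. -/
lemma eq_zero_of_countable_range {c : I → ℂ} (hc : Continuous c) (hcount : (Set.range c).Countable)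
    (h0 : c 0 = 0) (s : I) : c s = 0 := by
  have h := hcount.isTotallyDisconnected (Set.range c) subset_rfl (isPreconnected_range hc)
  rw [← h0]
  exact h ⟨s, rfl⟩ ⟨0, rfl⟩

lemma eq_zero_of_exp_eq_one {c : I → ℂ} (hc : Continuous c) (hexp : ∀ s, Complex.exp (c s) = 1)
    (h0 : c 0 = 0) (s : I) : c s = 0 := by
  refine eq_zero_of_countable_range hc ?_ h0 s
  refine (Set.countable_range fun n : ℤ => (n : ℂ) * (2 * Real.pi * Complex.I)).mono ?_
  rintro _ ⟨s, rfl⟩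
  obtain ⟨n, hn⟩ := Complex.exp_eq_one_iff.1 (hexp s)
  exact ⟨n, hn.symm⟩

/-- A family of zero-free paths has a family of logarithms with prescribed initial values.  They
depend continuously on any parameter on which the paths and the initial values depend
continuously. -/
lemma exists_log_family {B : Type*} (g : I → B → ℂ) (e : B → ℂ) (hg : ∀ b, Continuous (g · b))
    (hne : ∀ s b, g s b ≠ 0) (he : ∀ b, Complex.exp (e b) = g 0 b) :
    ∃ H : I → B → ℂ, (∀ b, Continuous (H · b)) ∧ (∀ b, H 0 b = e b) ∧
      (∀ s b, Complex.exp (H s b) = g s b) ∧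
      ∀ (A : Type) [TopologicalSpace A] (j : A → B),
        Continuous (fun p : I × A => g p.1 (j p.2)) → Continuous (e ∘ j) →
        Continuous fun p : I × A => H p.1 (j p.2) := by
  have hlift : ∀ b, ∃ Γ : C(I, ℂ), (∀ s, Complex.exp (Γ s) = g s b) ∧ Γ 0 = e b := by
    intro b
    obtain ⟨Γ, h1, h2⟩ := Complex.isCoveringMap_exp.exists_path_lifts
      ⟨fun s => ⟨g s b, hne s b⟩, (hg b).subtype_mk _⟩ (e b) (Subtype.ext (he b).symm)
    exact ⟨Γ, fun s => congrArg Subtype.val (congrFun h1 s), h2⟩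
  choose Γ hΓ hΓ0 using hlift
  refine ⟨fun s b => Γ b s, fun b => (Γ b).continuous, hΓ0, fun s b => hΓ b s, ?_⟩
  intro A _ j hcont he0
  refine Complex.isCoveringMap_exp.isLocalHomeomorph.continuous_lift
    Complex.isCoveringMap_exp.isSeparatedMap
    ⟨fun p : I × A => ⟨g p.1 (j p.2), hne _ _⟩, hcont.subtype_mk _⟩ ?_ ?_ fun a =>
      (Γ (j a)).continuous
  · funext p
    exact Subtype.ext (hΓ _ _)
  · convert he0 with a
    exact hΓ0 _

end Logarithm

/-! ### The normalized exponents -/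

section Exponents

open unitInterval

variable {d : ℕ} {D : Set (EuclideanSpace ℝ (Fin d))} {Ω : Type*} [mΩ : MeasurableSpace Ω]
  {𝔽 : Filtration ℝ≥0 mΩ} {P : OnePoint D → Measure Ω} {X : ℝ≥0 → Ω → OnePoint D}
  {Φ : ℝ≥0 → EuclideanSpace ℂ (Fin d) → ℂ}
  {Ψ : ℝ≥0 → EuclideanSpace ℂ (Fin d) → EuclideanSpace ℂ (Fin d)}

lemma toNNReal_mul_le (s : I) (t : ℝ≥0) : toNNReal s * t ≤ t :=
  mul_le_of_le_one_left t.2 s.2.2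

lemma continuous_fourierLaplace_mul (hM : IsMarkovProcess 𝔽 P X) (hA : IsAffine P X Φ Ψ) (k : ℕ)
    (x : D) : Continuous fun p : I × cQk D Φ k =>
      fourierLaplace P X (toNNReal p.1 * p.2.1.1) x p.2.1.2 :=
  (continuousOn_fourierLaplace hM hA.stochasticallyContinuous k x).comp_continuous
    (f := fun p : I × cQk D Φ k => (toNNReal p.1 * p.2.1.1, p.2.1.2))
    (by fun_prop) fun p => ⟨trivial, p.2.2.1⟩

/-- The exponents are interpolated from the logarithms of the Fourier–Laplace transform at finitely
many starting points.  The logarithms are taken along the time paths `s ↦ s t`, with the initial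
value `⟨u, x⟩`, so that `φ(0, u) = 0` and `ψ(0, u) = u`. -/
lemma exists_normalized (hD_nonempty : D.Nonempty) (hD : affineSpan ℝ D = ⊤)
    (hM : IsMarkovProcess 𝔽 P X) (hA : IsAffine P X Φ Ψ) :
    ∃ (φ : ℝ≥0 → EuclideanSpace ℂ (Fin d) → ℂ)
      (ψ : ℝ≥0 → EuclideanSpace ℂ (Fin d) → EuclideanSpace ℂ (Fin d)),
      IsNormalized P X Φ φ ψ ∧ ∀ u ∈ cU D, φ 0 u = 0 ∧ ψ 0 u = u := by
  obtain ⟨ι, _, p, c, L, hL, hLc⟩ := exists_interpolation hD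
  have hne : ∀ (x : D) (s : I) (b : cQ D Φ),
      fourierLaplace P X (toNNReal s * b.1.1) x b.1.2 ≠ 0 := by
    intro x s b
    obtain ⟨k, hk⟩ := Set.mem_iUnion.1 b.2
    exact hA.fourierLaplace_ne_zero (mem_cQk_of_le hk (toNNReal_mul_le s _)) x
  have hlog : ∀ x : D, ∃ H : I → cQ D Φ → ℂ, (∀ b, Continuous (H · b)) ∧
      (∀ b, H 0 b = pair b.1.2 x) ∧
      (∀ s b, Complex.exp (H s b) = fourierLaplace P X (toNNReal s * b.1.1) x b.1.2) ∧
      ∀ (A : Type) [TopologicalSpace A] (j : A → cQ D Φ),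
        Continuous (fun p : I × A => fourierLaplace P X (toNNReal p.1 * (j p.2).1.1) x (j p.2).1.2) →
        Continuous ((fun b : cQ D Φ => pair b.1.2 x) ∘ j) →
        Continuous fun p : I × A => H p.1 (j p.2) := by
    intro x
    refine exists_log_family
      (fun s (b : cQ D Φ) => fourierLaplace P X (toNNReal s * b.1.1) x b.1.2)
      (fun b => pair b.1.2 x) ?_ (hne x) ?_
    · intro b
      obtain ⟨k, hk⟩ := Set.mem_iUnion.1 b.2
      exact (continuous_fourierLaplace_mul hM hA k x).comp
        (continuous_id.prodMk (continuous_const (y := (⟨b.1, hk⟩ : cQk D Φ k))))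
    · intro b
      simp [hM.fourierLaplace_zero]
  choose H hHc hH0 hHexp hHA using hlog
  have hLw : ∀ w y, ∑ i, (c i y : ℂ) * affineEval w (p i) = affineEval w y := fun w y => by
    rw [← hLc, hL]
  -- The logarithm at `y` is the interpolation of the logarithms at the nodes: the difference is
  -- an element of a countable set that depends continuously on time.
  have hHL : ∀ (y : D) b s, H y s b = ∑ i, (c i y : ℂ) * H (p i) s b := by
    intro y b
    let f : ℤ × (ι → ℤ) → ℂ := fun n => n.1 * (2 * Real.pi * Complex.I) -
      ∑ i, (c i y : ℂ) * (n.2 i * (2 * Real.pi * Complex.I))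
    have hbU : b.1.2 ∈ cU D := by
      obtain ⟨k, hk⟩ := Set.mem_iUnion.1 b.2
      exact cUk_subset_cU k hk.1
    have key := eq_zero_of_countable_range (c := fun s => H y s b - ∑ i, (c i y : ℂ) * H (p i) s b)
      ((hHc y b).sub (continuous_finsetSum _ fun i _ => continuous_const.mul (hHc (p i) b)))
      ((Set.countable_range f).mono ?_) ?_
    · exact fun s => sub_eq_zero.1 (key s)
    · rintro _ ⟨s, rfl⟩
      let τ : ℝ≥0 := toNNReal s * b.1.1
      have hΦ : Φ τ b.1.2 ≠ 0 :=
        (hA.fourierLaplace_ne_zero_iff hbU τ y).1 (hne y s b)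
      let w : ℂ × EuclideanSpace ℂ (Fin d) := (Complex.log (Φ τ b.1.2), Ψ τ b.1.2)
      have hx : ∀ x : D, ∃ n : ℤ, H x s b = affineEval w x + n * (2 * Real.pi * Complex.I) := by
        intro x
        refine Complex.exp_eq_exp_iff_exists_int.1 ?_
        rw [hHexp, hA.affine τ x _ hbU, affineEval, Complex.exp_add, Complex.exp_log hΦ]
      choose n hn using hx
      refine ⟨(n y, fun i => n (p i)), ?_⟩
      simp only [f, hn, mul_add, Finset.sum_add_distrib, hLw]
      ring
    · simp only [hH0]
      have := hLw (0, b.1.2) y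
      simp only [affineEval, zero_add] at this
      rw [this, sub_self]
  let W : cQ D Φ → ℂ × EuclideanSpace ℂ (Fin d) := fun b => L fun i => H (p i) 1 b
  have hW : ∀ b (y : D), affineEval (W b) y = H y 1 b := fun b y => by
    rw [hHL, ← hLc]
  have hW0 : ∀ u (h : ((0 : ℝ≥0), u) ∈ cQ D Φ), W ⟨(0, u), h⟩ = (0, u) := by
    intro u h
    rw [← hL (0, u)]
    refine congrArg L (funext fun i => ?_)
    have h0 := eq_zero_of_exp_eq_one (c := fun s => H (p i) s ⟨(0, u), h⟩ - pair u (p i))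
      ((hHc _ _).sub continuous_const) (fun s => ?_) ?_ 1
    · simpa [affineEval] using sub_eq_zero.1 h0
    · rw [Complex.exp_sub, hHexp]
      simp [hM.fourierLaplace_zero]
    · simp [hH0]
  have hWc : ∀ k, Continuous fun a : cQk D Φ k => W ⟨a.1, Set.mem_iUnion.2 ⟨k, a.2⟩⟩ := by
    intro k
    refine L.continuous.comp (continuous_pi fun i => ?_)
    have := hHA (p i) (cQk D Φ k) (fun a => ⟨a.1, Set.mem_iUnion.2 ⟨k, a.2⟩⟩)
      (continuous_fourierLaplace_mul hM hA k (p i))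
      (continuous_pair.comp ((continuous_snd.comp continuous_subtype_val).prodMk continuous_const))
    exact this.comp (continuous_const.prodMk continuous_id)
  have hmem0 : ∀ u ∈ cU D, ((0 : ℝ≥0), u) ∈ cQ D Φ := by
    intro u hu
    obtain ⟨k, hk⟩ := exists_mem_cUk hu
    exact Set.mem_iUnion.2 ⟨k, hk, lifetime_pos hD_nonempty hM hA hu⟩
  classical
  let V : ℝ≥0 × EuclideanSpace ℂ (Fin d) → ℂ × EuclideanSpace ℂ (Fin d) := fun q =>
    if h : q ∈ cQ D Φ then W ⟨q, h⟩ else 0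
  have hV : ∀ q (h : q ∈ cQ D Φ), V q = W ⟨q, h⟩ := fun q h => dif_pos h
  have hVc : ∀ k, ContinuousOn V (cQk D Φ k) := by
    intro k
    rw [continuousOn_iff_continuous_domRestrict]
    convert hWc k with a
    exact hV a.1 _
  have hV0 : ∀ u ∈ cU D, V (0, u) = (0, u) := fun u hu => by
    rw [hV _ (hmem0 u hu), hW0]
  have h00 : (0 : EuclideanSpace ℂ (Fin d)) ∈ cU D := cUk_subset_cU 0 (zero_mem_cUk 0)
  refine ⟨fun t u => (V (t, u)).1, fun t u => (V (t, u)).2,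
    ⟨fun t u h x => ?_, fun k => (hVc k).fst, fun k => (hVc k).snd, ?_, ?_⟩, fun u hu => ?_⟩
  · change _ = Complex.exp (affineEval (V (t, u)) x)
    rw [hV _ h, hW, hHexp]
    simp
  · simp [hV0 0 h00]
  · simp [hV0 0 h00]
  · simp [hV0 u hu]

/-- Two choices of normalized exponents differ by an element of `2πiℤ` at every starting point; the
difference is constant along the path from `(0, 0)` over `(0, u)` to `(t, u)`. -/
lemma IsNormalized.unique (hD_nonempty : D.Nonempty) (hD : affineSpan ℝ D = ⊤)
    (hM : IsMarkovProcess 𝔽 P X) (hA : IsAffine P X Φ Ψ)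
    {φ φ' : ℝ≥0 → EuclideanSpace ℂ (Fin d) → ℂ}
    {ψ ψ' : ℝ≥0 → EuclideanSpace ℂ (Fin d) → EuclideanSpace ℂ (Fin d)}
    (h : IsNormalized P X Φ φ ψ) (h' : IsNormalized P X Φ φ' ψ') {t : ℝ≥0}
    {u : EuclideanSpace ℂ (Fin d)} (htu : (t, u) ∈ cQ D Φ) : φ' t u = φ t u ∧ ψ' t u = ψ t u := by
  obtain ⟨ι, _, p, c, L, hL, -⟩ := exists_interpolation hD
  obtain ⟨k, hk⟩ := Set.mem_iUnion.1 htu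
  let δ : ℝ≥0 × EuclideanSpace ℂ (Fin d) → ℂ × EuclideanSpace ℂ (Fin d) := fun q =>
    (φ' q.1 q.2, ψ' q.1 q.2) - (φ q.1 q.2, ψ q.1 q.2)
  have hδ : ContinuousOn δ (cQk D Φ k) :=
    ((h'.continuousOn_phi k).prodMk (h'.continuousOn_psi k)).sub
      ((h.continuousOn_phi k).prodMk (h.continuousOn_psi k))
  have hexp : ∀ q ∈ cQk D Φ k, ∀ y : D, Complex.exp (affineEval (δ q) y) = 1 := by
    intro q hq y
    have hq' : (q.1, q.2) ∈ cQ D Φ := Set.mem_iUnion.2 ⟨k, hq⟩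
    rw [affineEval_sub, Complex.exp_sub, div_eq_one_iff_eq (Complex.exp_ne_zero _)]
    exact (h'.eq_exp _ _ hq' y).symm.trans (h.eq_exp _ _ hq' y)
  have hpath : ∀ (γ : I → ℝ≥0 × EuclideanSpace ℂ (Fin d)), Continuous γ →
      (∀ s, γ s ∈ cQk D Φ k) → ∀ y : D, affineEval (δ (γ 0)) y = 0 →
      affineEval (δ (γ 1)) y = 0 := fun γ hγ hmem y h0 =>
    eq_zero_of_exp_eq_one (c := fun s => affineEval (δ (γ s)) y)
      ((continuous_affineEval_left _).comp (hδ.comp_continuous hγ hmem))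
      (fun s => hexp _ (hmem s) y) h0 1
  have hzero : ∀ y : D, affineEval (δ (t, u)) y = 0 := by
    intro y
    have h0 : affineEval (δ (0, 0)) y = 0 := by
      simp [δ, h.phi_zero, h.psi_zero, h'.phi_zero, h'.psi_zero, affineEval, pair_zero_left]
    have h1 := hpath (fun s => (0, ((s : ℝ) : ℂ) • u)) (by fun_prop)
      (fun s => ⟨smul_mem_cUk hk.1 s.2.1 s.2.2, lifetime_pos hD_nonempty hM hA
        (cUk_subset_cU k (smul_mem_cUk hk.1 s.2.1 s.2.2))⟩) y (by simpa using h0)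
    have h2 := hpath (fun s => (toNNReal s * t, u)) (by fun_prop)
      (fun s => mem_cQk_of_le hk (toNNReal_mul_le s t)) y (by simpa using h1)
    simpa using h2
  have : δ (t, u) = 0 := by
    rw [← hL (δ (t, u))]
    simp only [hzero]
    exact L.map_zero
  exact Prod.ext_iff.1 (sub_eq_zero.1 this)

end Exponents

/-! ### Exit times on time grids -/

section Grid

/-- The index of the first point of the grid `0, h, 2h, …` that lies in `S`. -/
noncomputable def gridIndex (S : Set ℝ≥0) (h : ℝ≥0) : ℕ := sInf {j : ℕ | (j : ℝ≥0) * h ∈ S}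

lemma notMem_of_lt_gridIndex {S : Set ℝ≥0} {h : ℝ≥0} {j : ℕ} (hj : j < gridIndex S h) :
    (j : ℝ≥0) * h ∉ S := Nat.notMem_of_lt_sInf hj

lemma gridIndex_le {S : Set ℝ≥0} {h : ℝ≥0} {j : ℕ} (hj : (j : ℝ≥0) * h ∈ S) :
    gridIndex S h ≤ j := Nat.sInf_le hj

lemma ceil_mul_mem {S : Set ℝ≥0} {T h : ℝ≥0} (hS : Set.Ici T ⊆ S) (hh : 0 < h) :
    ((⌈T / h⌉₊ : ℕ) : ℝ≥0) * h ∈ S :=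
  hS ((div_le_iff₀ hh).1 (Nat.le_ceil _))

lemma gridIndex_mul_mem {S : Set ℝ≥0} {T h : ℝ≥0} (hS : Set.Ici T ⊆ S) (hh : 0 < h) :
    (gridIndex S h : ℝ≥0) * h ∈ S :=
  Nat.sInf_mem (s := {j : ℕ | (j : ℝ≥0) * h ∈ S}) ⟨_, ceil_mul_mem hS hh⟩

lemma lt_gridIndex_iff {S : Set ℝ≥0} {T h : ℝ≥0} (hS : Set.Ici T ⊆ S) (hh : 0 < h) {j : ℕ} :
    j < gridIndex S h ↔ ∀ i ≤ j, (i : ℝ≥0) * h ∉ S := by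
  refine ⟨fun hj i hi => notMem_of_lt_gridIndex (hi.trans_lt hj), fun hj => ?_⟩
  by_contra! hle
  exact hj _ hle (gridIndex_mul_mem hS hh)

/-- If every point of `S` is followed by an interval contained in `S`, then the first grid point
in `S` approaches `inf S` from above as the mesh tends to `0`. -/
lemma tendsto_gridIndex_mul {S : Set ℝ≥0} {T : ℝ≥0} (hS : Set.Ici T ⊆ S)
    (hopen : ∀ s ∈ S, S ∈ 𝓝[≥] s) :
    Tendsto (fun h : ℝ≥0 => (gridIndex S h : ℝ≥0) * h) (𝓝[>] 0) (𝓝[≥] (sInf S)) := by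
  have hpos : ∀ᶠ h : ℝ≥0 in 𝓝[>] 0, 0 < h := eventually_mem_nhdsWithin
  have hge : ∀ᶠ h : ℝ≥0 in 𝓝[>] 0, sInf S ≤ (gridIndex S h : ℝ≥0) * h :=
    hpos.mono fun h hh => csInf_le (OrderBot.bddBelow S) (gridIndex_mul_mem hS hh)
  refine tendsto_nhdsWithin_iff.2 ⟨tendsto_order.2 ⟨fun a ha => ?_, fun b hb => ?_⟩, hge⟩
  · exact hge.mono fun h hh => ha.trans_le hh
  · obtain ⟨s, hs, hsb⟩ := exists_lt_of_csInf_lt ⟨T, hS Set.self_mem_Ici⟩ hb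
    obtain ⟨e, hse, he⟩ := mem_nhdsGE_iff_exists_Ico_subset.1 (hopen s hs)
    have hlt : s < min e b := lt_min hse hsb
    have hsmall : ∀ᶠ h : ℝ≥0 in 𝓝[>] 0, h < min e b - s :=
      mem_nhdsWithin_of_mem_nhds (gt_mem_nhds (tsub_pos_of_lt hlt))
    filter_upwards [hpos, hsmall] with h hh hhs
    -- the first grid point after `s` lies in `S` and before `b`
    have h1 : s ≤ ((⌈s / h⌉₊ : ℕ) : ℝ≥0) * h := (div_le_iff₀ hh).1 (Nat.le_ceil _)
    have h2 : ((⌈s / h⌉₊ : ℕ) : ℝ≥0) * h < min e b := by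
      calc ((⌈s / h⌉₊ : ℕ) : ℝ≥0) * h < (s / h + 1) * h := by
            gcongr
            exact Nat.ceil_lt_add_one zero_le
        _ = s + h := by field_simp
        _ < min e b := by
            exact lt_tsub_iff_left.1 hhs
    have h3 := gridIndex_le (he ⟨h1, h2.trans_le (min_le_left _ _)⟩)
    calc (gridIndex S h : ℝ≥0) * h ≤ ((⌈s / h⌉₊ : ℕ) : ℝ≥0) * h := by gcongr
      _ < b := h2.trans_le (min_le_right _ _)

end Grid

section Exit

variable {d : ℕ} {D : Set (EuclideanSpace ℝ (Fin d))} {Ω : Type*}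
  {X : ℝ≥0 → Ω → OnePoint D}

/-- The closed ball of `D` as a subset of `D̂`. -/
def ballOnePoint (x : D) (r : ℝ) : Set (OnePoint D) := (↑) '' Metric.closedBall x r

lemma measurableSet_ballOnePoint (x : D) (r : ℝ) : MeasurableSet (ballOnePoint x r) := by
  change MeasurableSet ((fun z : D => (z : OnePoint D)) ⁻¹' ((↑) '' Metric.closedBall x r))
  rw [Set.preimage_image_eq _ OnePoint.coe_injective]
  exact Metric.isClosed_closedBall.measurableSet

/-- The times at which the path is outside the ball, together with all times from `T` on. -/
def exitSet (X : ℝ≥0 → Ω → OnePoint D) (x : D) (r : ℝ) (T : ℝ≥0) (ω : Ω) : Set ℝ≥0 :=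
  {s | T ≤ s ∨ X s ω ∉ ballOnePoint x r}

lemma Ici_subset_exitSet (x : D) (r : ℝ) (T : ℝ≥0) (ω : Ω) :
    Set.Ici T ⊆ exitSet X x r T ω := fun _ hs => Or.inl hs

/-- The properties of a typical path under `ℙ^x` that are used below: it starts in `x`, is
right-continuous, and is absorbed in the cemetery state. -/
structure IsRegularPath (X : ℝ≥0 → Ω → OnePoint D) (x : D) (ω : Ω) : Prop where
  start : X 0 ω = x
  rightCont : ∀ t, ContinuousWithinAt (fun s => X s ω) (Set.Ici t) t
  absorbed : ∀ s t, s ≤ t → X s ω = OnePoint.infty → X t ω = OnePoint.infty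

variable {x : D} {r : ℝ} {T : ℝ≥0} {ω : Ω}

/-- The complement of the ball need not be open at the cemetery state, as closed balls of `D` need
not be compact; there the absorption of the path is used. -/
lemma IsRegularPath.exitSet_mem_nhdsGE (hω : IsRegularPath X x ω) {s : ℝ≥0}
    (hs : s ∈ exitSet X x r T ω) : exitSet X x r T ω ∈ 𝓝[≥] s := by
  rcases hs with hs | hs
  · exact mem_of_superset self_mem_nhdsWithin fun t ht => Or.inl (hs.trans ht)
  · cases hX : X s ω using OnePoint.rec with
    | infty =>
      refine mem_of_superset self_mem_nhdsWithin fun t ht => Or.inr ?_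
      rw [hω.absorbed s t ht hX]
      rintro ⟨z, -, hz⟩
      exact OnePoint.coe_ne_infty z hz
    | coe z =>
      have hz : z ∈ (Metric.closedBall x r)ᶜ := fun hz => hs (hX ▸ ⟨z, hz, rfl⟩)
      have hnhds : ((↑) '' (Metric.closedBall x r)ᶜ : Set (OnePoint D)) ∈ 𝓝 (X s ω) := by
        rw [hX, OnePoint.nhds_coe_eq]
        exact image_mem_map (Metric.isClosed_closedBall.isOpen_compl.mem_nhds hz)
      filter_upwards [hω.rightCont s hnhds] with t ht
      refine Or.inr ?_
      rintro ⟨y, hy, hyt⟩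
      obtain ⟨y', hy', hyt'⟩ := ht
      exact hy' (OnePoint.coe_injective (hyt.trans hyt'.symm) ▸ hy)

lemma tendsto_expPair {α : Type*} {l : Filter α} {v : α → EuclideanSpace ℂ (Fin d)}
    {Y : α → OnePoint D} {u : EuclideanSpace ℂ (Fin d)} {z : D} (hv : Tendsto v l (𝓝 u))
    (hY : Tendsto Y l (𝓝 (z : OnePoint D))) :
    Tendsto (fun a => expPair (v a) (Y a)) l (𝓝 (expPair u (z : OnePoint D))) := by
  suffices h : Tendsto (fun p : EuclideanSpace ℂ (Fin d) × OnePoint D => expPair p.1 p.2)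
      (𝓝 u ×ˢ 𝓝 (z : OnePoint D)) (𝓝 (expPair u (z : OnePoint D))) by
    have hcomp := Tendsto.comp h (hv.prodMk hY)
    exact hcomp
  rw [OnePoint.nhds_coe_eq, ← map_id (f := 𝓝 u), prod_map_map_eq, tendsto_map'_iff,
    ← nhds_prod_eq]
  have : Continuous fun p : EuclideanSpace ℂ (Fin d) × D => Complex.exp (pair p.1 p.2) :=
    Complex.continuous_exp.comp
      (continuous_pair.comp (continuous_fst.prodMk (continuous_subtype_val.comp continuous_snd)))
  exact this.tendsto (u, z)

/-- Along grids of vanishing mesh, the exponential at the first grid point in the exit set converges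
to the exponential at the infimum of the exit set, whatever the grids. -/
lemma IsRegularPath.tendsto_expPair_exit (hω : IsRegularPath X x ω) (r : ℝ) (T : ℝ≥0)
    (l : Filter (EuclideanSpace ℂ (Fin d))) {u : EuclideanSpace ℂ (Fin d)} (hl : l ≤ 𝓝 u) :
    Tendsto (fun p : ℝ≥0 × EuclideanSpace ℂ (Fin d) =>
        expPair p.2 (X ((gridIndex (exitSet X x r T ω) p.1 : ℝ≥0) * p.1) ω))
      (𝓝[>] 0 ×ˢ l) (𝓝 (expPair u (X (sInf (exitSet X x r T ω)) ω))) := by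
  have hκ := (tendsto_gridIndex_mul (Ici_subset_exitSet x r T ω)
    fun s hs => hω.exitSet_mem_nhdsGE hs).comp (tendsto_fst (g := l))
  cases hX : X (sInf (exitSet X x r T ω)) ω using OnePoint.rec with
  | infty =>
    refine tendsto_const_nhds.congr' ?_
    filter_upwards [hκ.eventually eventually_mem_nhdsWithin] with p hp
    have h : X ((gridIndex (exitSet X x r T ω) p.1 : ℝ≥0) * p.1) ω = OnePoint.infty :=
      hω.absorbed _ _ hp hX
    rw [h, expPair_infty, expPair_infty]
  | coe z =>
    have h1 : Tendsto (fun p : ℝ≥0 × EuclideanSpace ℂ (Fin d) =>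
        X ((gridIndex (exitSet X x r T ω) p.1 : ℝ≥0) * p.1) ω) (𝓝[>] 0 ×ˢ l)
        (𝓝 (X (sInf (exitSet X x r T ω)) ω)) :=
      (hω.rightCont (sInf (exitSet X x r T ω))).tendsto.comp hκ
    rw [hX] at h1
    have h2 : Tendsto (fun p : ℝ≥0 × EuclideanSpace ℂ (Fin d) => p.2) (𝓝[>] 0 ×ˢ l) (𝓝 u) :=
      tendsto_snd.mono_right hl
    exact tendsto_expPair h2 h1

/-- The event that the path leaves the ball before time `T`, detected on a countable dense set of
times. -/
def earlyExit (X : ℝ≥0 → Ω → OnePoint D) (x : D) (r : ℝ) (T : ℝ≥0) : Set Ω :=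
  {ω | ∃ n, TopologicalSpace.denseSeq ℝ≥0 n < T ∧
    X (TopologicalSpace.denseSeq ℝ≥0 n) ω ∉ ballOnePoint x r}

lemma IsRegularPath.mem_earlyExit (hω : IsRegularPath X x ω) {s : ℝ≥0} (hsT : s < T)
    (hs : X s ω ∉ ballOnePoint x r) : ω ∈ earlyExit X x r T := by
  obtain ⟨e, hse, he⟩ := mem_nhdsGE_iff_exists_Ico_subset.1
    (hω.exitSet_mem_nhdsGE (r := r) (T := T) (Or.inr hs))
  obtain ⟨_, ⟨h1, h2⟩, n, rfl⟩ := (TopologicalSpace.denseRange_denseSeq ℝ≥0).exists_mem_open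
    (isOpen_Ioo (a := s) (b := min e T)) (Set.nonempty_Ioo.2 (lt_min hse hsT)) |>.elim
      fun n hn => (⟨_, hn, n, rfl⟩ : ∃ q, q ∈ Set.Ioo s (min e T) ∧
        ∃ n, TopologicalSpace.denseSeq ℝ≥0 n = q)
  have hT := h2.trans_le (min_le_right _ _)
  exact ⟨n, hT, (he ⟨h1.le, h2.trans_le (min_le_left _ _)⟩).resolve_left hT.not_ge⟩

variable [mΩ : MeasurableSpace Ω] {𝔽 : Filtration ℝ≥0 mΩ} {P : OnePoint D → Measure Ω}

lemma ae_isRegularPath (hM : IsMarkovProcess 𝔽 P X) (hC : IsCadlag P X) (x : D) :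
    ∀ᵐ ω ∂(P x), IsRegularPath X x ω := by
  have := hM.isProbabilityMeasure (x : OnePoint D)
  have h0 : ∀ᵐ ω ∂(P x), X 0 ω = x := by
    have h := hM.normal (x : OnePoint D)
    rw [transition, Measure.map_apply (hM.measurable 0) (measurableSet_singleton_coe x),
      ← prob_compl_eq_zero_iff (hM.measurable 0 (measurableSet_singleton_coe x))] at h
    rwa [ae_iff]
  filter_upwards [h0, hC x, hM.path_absorbing x] with ω h1 h2 h3
  exact ⟨h1, fun t => (h2 t).1, h3⟩

lemma measurableSet_earlyExit (hM : IsMarkovProcess 𝔽 P X) (x : D) (r : ℝ) (T : ℝ≥0) :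
    MeasurableSet (earlyExit X x r T) := by
  have : earlyExit X x r T = ⋃ n, {ω | TopologicalSpace.denseSeq ℝ≥0 n < T ∧
      X (TopologicalSpace.denseSeq ℝ≥0 n) ω ∉ ballOnePoint x r} := by
    ext ω
    simp [earlyExit]
  rw [this]
  exact MeasurableSet.iUnion fun n => (MeasurableSet.const _).inter
    (hM.measurable _ (measurableSet_ballOnePoint x r)).compl

/-- By right-continuity the path does not leave the ball immediately. -/
lemma exists_earlyExit_le (hM : IsMarkovProcess 𝔽 P X) (hC : IsCadlag P X) (x : D) {r : ℝ}
    (hr : 0 < r) {ε : ℝ} (hε : 0 < ε) : ∃ T : ℝ≥0, 0 < T ∧ (P x).real (earlyExit X x r T) ≤ ε := by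
  have := hM.isProbabilityMeasure (x : OnePoint D)
  have hanti : Antitone fun n : ℕ => earlyExit X x r (1 / ((n : ℝ≥0) + 1)) := by
    rintro m n hmn ω ⟨j, hj, hjω⟩
    refine ⟨j, hj.trans_le ?_, hjω⟩
    gcongr
  have hlim := tendsto_measure_iInter_atTop (μ := P x)
    (fun n : ℕ => (measurableSet_earlyExit hM x r (1 / ((n : ℝ≥0) + 1))).nullMeasurableSet) hanti
    ⟨0, measure_ne_top _ _⟩
  have hnull : P x (⋂ n : ℕ, earlyExit X x r (1 / ((n : ℝ≥0) + 1))) = 0 := by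
    refine measure_eq_zero_iff_ae_notMem.2 ((ae_isRegularPath hM hC x).mono fun ω hω hmem => ?_)
    have hnhds : ballOnePoint x r ∈ 𝓝 (X 0 ω) := by
      rw [hω.start, OnePoint.nhds_coe_eq]
      exact image_mem_map (Metric.closedBall_mem_nhds x hr)
    obtain ⟨e, he0, he⟩ := mem_nhdsGE_iff_exists_Ico_subset.1 (hω.rightCont 0 hnhds)
    have he0' : (0 : ℝ) < e := NNReal.coe_pos.2 he0
    obtain ⟨n, hn⟩ := exists_nat_one_div_lt he0'
    obtain ⟨j, hj, hjω⟩ := Set.mem_iInter.1 hmem n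
    have hn' : 1 / ((n : ℝ≥0) + 1) < e := by
      rw [← NNReal.coe_lt_coe]
      simpa using hn
    exact hjω (he ⟨zero_le, hj.trans hn'⟩)
  rw [hnull] at hlim
  obtain ⟨n, hn⟩ := (hlim.eventually (gt_mem_nhds (ENNReal.ofReal_pos.2 hε))).exists
  exact ⟨1 / ((n : ℝ≥0) + 1), by positivity, ENNReal.toReal_le_of_le_ofReal hε.le hn.le⟩

end Exit

/-! ### The Markov property and a discrete Dynkin formula -/

section Dynkin

variable {d : ℕ} {D : Set (EuclideanSpace ℝ (Fin d))} {Ω : Type*} [mΩ : MeasurableSpace Ω]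
  {𝔽 : Filtration ℝ≥0 mΩ} {P : OnePoint D → Measure Ω} {X : ℝ≥0 → Ω → OnePoint D}

/-- The transition function as a Markov kernel on `D̂`. -/
noncomputable def IsMarkovProcess.kernel (hM : IsMarkovProcess 𝔽 P X) (t : ℝ≥0) :
    Kernel (OnePoint D) (OnePoint D) :=
  ⟨transition P X t, Measure.measurable_of_measurable_coe _ (hM.measurable_trans t)⟩

/-- On an event of `ℱ_s`, the law of `X_{s+t}` is the law of `X_s` composed with the transition
kernel. -/
lemma IsMarkovProcess.map_restrict (hM : IsMarkovProcess 𝔽 P X) (x : OnePoint D) (s t : ℝ≥0)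
    {A : Set Ω} (hA : MeasurableSet[𝔽 s] A) :
    ((P x).restrict A).map (X (s + t)) =
      (((P x).restrict A).map (X s)).bind (hM.kernel t) := by
  have := hM.isProbabilityMeasure x
  have hA' : MeasurableSet A := 𝔽.le s A hA
  ext C hC
  have hpre : MeasurableSet (X (s + t) ⁻¹' C) := hM.measurable _ hC
  have hmeas : Measurable fun ω => transition P X t (X s ω) C :=
    (hM.measurable_trans t C hC).comp (hM.measurable s)
  have hle : ∀ ω, transition P X t (X s ω) C ≤ 1 := fun ω =>
    have := hM.isProbabilityMeasure_transition t (X s ω)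
    prob_le_one
  rw [Measure.map_apply (hM.measurable _) hC, Measure.restrict_apply hpre,
    Measure.bind_apply hC (hM.kernel t).measurable.aemeasurable,
    lintegral_map ((hM.kernel t).measurable_coe hC) (hM.measurable s)]
  have h1 : ∫ ω in A, ((P x)⟦X (s + t) ⁻¹' C | 𝔽 s⟧) ω ∂(P x) =
      ((P x) (X (s + t) ⁻¹' C ∩ A)).toReal := by
    rw [setIntegral_condExp (𝔽.le s) ((integrable_const (1 : ℝ)).indicator hpre) hA,
      setIntegral_indicator hpre, setIntegral_const, smul_eq_mul, mul_one, Set.inter_comm]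
    rfl
  have h2 : ∫ ω in A, ((P x)⟦X (s + t) ⁻¹' C | 𝔽 s⟧) ω ∂(P x) =
      (∫⁻ ω in A, transition P X t (X s ω) C ∂(P x)).toReal := by
    rw [← integral_toReal hmeas.aemeasurable
      (ae_of_all _ fun ω => (hle ω).trans_lt ENNReal.one_lt_top)]
    exact integral_congr_ae (ae_restrict_of_ae (hM.markov x s t C hC))
  refine (ENNReal.toReal_eq_toReal_iff' (measure_ne_top _ _) ?_).1 (h1.symm.trans h2)
  refine ne_top_of_le_ne_top ENNReal.one_ne_top ((lintegral_mono hle).trans ?_)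
  simpa using prob_le_one

lemma IsMarkovProcess.setIntegral_expPair (hM : IsMarkovProcess 𝔽 P X) (x : OnePoint D)
    (s t : ℝ≥0) {A : Set Ω} (hA : MeasurableSet[𝔽 s] A) {k : ℕ} {u : EuclideanSpace ℂ (Fin d)}
    (hu : u ∈ cUk D k) :
    ∫ ω in A, expPair u (X (s + t) ω) ∂(P x) =
      ∫ ω in A, (∫ y, expPair u y ∂(transition P X t (X s ω))) ∂(P x) := by
  have := hM.isProbabilityMeasure x
  have hf := measurable_expPair (D := D) u
  let κ : Kernel Unit (OnePoint D) := Kernel.const Unit (((P x).restrict A).map (X s))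
  have hκ : ((hM.kernel t).comp κ) () = ((P x).restrict A).map (X (s + t)) := by
    rw [hM.map_restrict x s t hA, Kernel.comp_apply]
    rfl
  have hint : Integrable (expPair u : OnePoint D → ℂ) (((hM.kernel t).comp κ) ()) := by
    rw [hκ]
    exact integrable_of_measurable_of_norm_le hf (norm_expPair_le hu)
  have key := Kernel.integral_comp hint
  rw [hκ, integral_map (hM.measurable _).aemeasurable hf.aestronglyMeasurable] at key
  rw [key]
  refine integral_map (hM.measurable s).aemeasurable ?_
  exact (hf.stronglyMeasurable.integral_kernel (κ := hM.kernel t)).aestronglyMeasurable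

lemma measurableSet_lt_gridIndex (hM : IsMarkovProcess 𝔽 P X) (x : D) (r : ℝ) (T : ℝ≥0) {h : ℝ≥0}
    (hh : 0 < h) (j : ℕ) :
    MeasurableSet[𝔽 (j * h)] {ω | j < gridIndex (exitSet X x r T ω) h} := by
  have : {ω | j < gridIndex (exitSet X x r T ω) h} =
      ⋂ i ∈ Set.Iic j, ({ω | ¬ T ≤ (i : ℝ≥0) * h} ∩ X ((i : ℝ≥0) * h) ⁻¹' ballOnePoint x r) := by
    ext ω
    rw [Set.mem_ofPred_eq, lt_gridIndex_iff (Ici_subset_exitSet x r T ω) hh]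
    simp [exitSet]
  rw [this]
  refine MeasurableSet.biInter (Set.to_countable _) fun i hi => ?_
  refine (MeasurableSet.const _).inter ?_
  refine 𝔽.mono ?_ _ (hM.adapted _ (measurableSet_ballOnePoint x r))
  have : (i : ℝ≥0) ≤ j := by exact_mod_cast hi
  gcongr

lemma measurable_expPair_exit (hM : IsMarkovProcess 𝔽 P X) (x : D) (r : ℝ) (T : ℝ≥0) {h : ℝ≥0}
    (hh : 0 < h) (u : EuclideanSpace ℂ (Fin d)) :
    Measurable fun ω => expPair u (X ((gridIndex (exitSet X x r T ω) h : ℝ≥0) * h) ω) := by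
  refine (measurable_expPair u).comp ?_
  have hK : Measurable fun ω => gridIndex (exitSet X x r T ω) h :=
    measurable_of_Ioi fun j => 𝔽.le _ _ (measurableSet_lt_gridIndex hM x r T hh j)
  exact (measurable_from_prod_countable_right (f := fun p : ℕ × Ω => X ((p.1 : ℝ≥0) * h) p.2)
    fun j => hM.measurable (j * h)).comp (hK.prodMk measurable_id)

/-- A telescoping sum up to a random index. -/
lemma sub_eq_sum_indicator (a : ℕ → ℂ) {K N : ℕ} (hK : K ≤ N) :
    a K - a 0 = ∑ j ∈ Finset.range N, if j < K then a (j + 1) - a j else 0 := by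
  rw [← Finset.sum_filter, ← Finset.sum_range_sub]
  refine Finset.sum_congr ?_ fun _ _ => rfl
  ext j
  simp only [Finset.mem_range, Finset.mem_filter]
  omega

/-- Discrete Dynkin estimate.  If the one-step increment of `e^{⟨u, ·⟩}` differs by at most `η` from
the constant `c` on a ball around the starting point, then the expected increment up to the exit
from the ball or to time `T`, whichever comes first, is the number of steps times `c`, up to an
error that is controlled by `η` and by the probability of an early exit. -/
lemma dynkin_estimate (hM : IsMarkovProcess 𝔽 P X) (hC : IsCadlag P X) (x : D) (r : ℝ) (T : ℝ≥0)
    {h : ℝ≥0} (hh : 0 < h) {k : ℕ} {u : EuclideanSpace ℂ (Fin d)} (hu : u ∈ cUk D k) {c : ℂ}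
    {η : ℝ} (hη : ∀ y : D, dist y x ≤ r →
      ‖fourierLaplace P X h y u - Complex.exp (pair u y) - c‖ ≤ η) (hη0 : 0 ≤ η) :
    ‖(∫ ω, expPair u (X ((gridIndex (exitSet X x r T ω) h : ℝ≥0) * h) ω) ∂(P x)) -
        Complex.exp (pair u x) - (⌈T / h⌉₊ : ℕ) * c‖ ≤
      (⌈T / h⌉₊ : ℕ) * (η + ‖c‖ * (P x).real (earlyExit X x r T)) := by
  have := hM.isProbabilityMeasure (x : OnePoint D)
  set N := ⌈T / h⌉₊ with hN
  set p := (P x).real (earlyExit X x r T) with hp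
  let K : Ω → ℕ := fun ω => gridIndex (exitSet X x r T ω) h
  let A : ℕ → Set Ω := fun j => {ω | j < K ω}
  have hAF : ∀ j : ℕ, MeasurableSet[𝔽 (j * h)] (A j) := measurableSet_lt_gridIndex hM x r T hh
  have hA : ∀ j, MeasurableSet (A j) := fun j => 𝔽.le _ _ (hAF j)
  have hKN : ∀ ω, K ω ≤ N := fun ω => gridIndex_le (ceil_mul_mem (Ici_subset_exitSet x r T ω) hh)
  have hball : ∀ j, ∀ ω ∈ A j, ∃ y : D, dist y x ≤ r ∧ X ((j : ℝ≥0) * h) ω = y := by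
    intro j ω hω
    have h1 := notMem_of_lt_gridIndex hω
    simp only [exitSet, Set.mem_ofPred_eq, not_or, not_not] at h1
    obtain ⟨y, hy, hyX⟩ := h1.2
    exact ⟨y, hy, hyX.symm⟩
  have hAc : ∀ j < N, (P x).real (A j)ᶜ ≤ p := by
    intro j hj
    have hjT : (j : ℝ≥0) * h < T := (lt_div_iff₀ hh).1 (Nat.lt_ceil.1 hj)
    have : (A j)ᶜ ≤ᵐ[P x] earlyExit X x r T := by
      filter_upwards [ae_isRegularPath hM hC x] with ω hω hjω
      have hjω' : ¬ j < K ω := hjω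
      rw [lt_gridIndex_iff (Ici_subset_exitSet x r T ω) hh] at hjω'
      push Not at hjω'
      obtain ⟨i, hi, hiS⟩ := hjω'
      have hiT : (i : ℝ≥0) * h < T := by
        refine lt_of_le_of_lt ?_ hjT
        gcongr
      exact hω.mem_earlyExit hiT (hiS.resolve_left hiT.not_ge)
    exact ENNReal.toReal_mono (measure_ne_top _ _) (measure_mono_ae this)
  let f : ℕ → Ω → ℂ := fun j ω => expPair u (X ((j : ℝ≥0) * h) ω)
  have hf : ∀ j, Integrable (f j) (P x) := fun j => integrable_of_measurable_of_norm_le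
    ((measurable_expPair u).comp (hM.measurable _)) fun ω => norm_expPair_le hu _
  have hfi : ∀ j, Integrable (fun ω => f (j + 1) ω - f j ω) (P x) := fun j =>
    (hf (j + 1)).sub (hf j)
  have hstart : ∫ ω, f 0 ω ∂(P x) = Complex.exp (pair u x) := by
    have : f 0 =ᵐ[P x] fun _ => Complex.exp (pair u x) := by
      filter_upwards [ae_isRegularPath hM hC x] with ω hω
      simp only [f, Nat.cast_zero, zero_mul, hω.start, expPair_coe]
    rw [integral_congr_ae this]
    simp
  have hsum : (∫ ω, expPair u (X ((K ω : ℝ≥0) * h) ω) ∂(P x)) - Complex.exp (pair u x) =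
      ∑ j ∈ Finset.range N, ∫ ω in A j, (f (j + 1) ω - f j ω) ∂(P x) := by
    rw [← hstart, ← integral_sub (integrable_of_measurable_of_norm_le
      (measurable_expPair_exit hM x r T hh u) fun ω => norm_expPair_le hu _) (hf 0)]
    have h1 : ∀ ω, expPair u (X ((K ω : ℝ≥0) * h) ω) - f 0 ω =
        ∑ j ∈ Finset.range N, (A j).indicator (fun ω => f (j + 1) ω - f j ω) ω := by
      intro ω
      refine (sub_eq_sum_indicator (fun j => f j ω) (hKN ω)).trans ?_
      refine Finset.sum_congr rfl fun j _ => ?_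
      classical
      rw [Set.indicator_apply]
      rfl
    rw [integral_congr_ae (ae_of_all _ h1), integral_finsetSum _ fun j _ => (hfi j).indicator (hA j)]
    exact Finset.sum_congr rfl fun j _ => integral_indicator (hA j)
  have hstep : ∀ j < N, ‖(∫ ω in A j, (f (j + 1) ω - f j ω) ∂(P x)) - c‖ ≤ η + ‖c‖ * p := by
    intro j hj
    let g : Ω → ℂ := fun ω => (∫ y, expPair u y ∂(transition P X h (X ((j : ℝ≥0) * h) ω))) - f j ω
    have hint : Integrable (fun ω => ∫ y, expPair u y ∂(transition P X h (X ((j : ℝ≥0) * h) ω)))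
        ((P x).restrict (A j)) := by
      refine integrable_of_measurable_of_norm_le (C := Real.exp k) ?_ fun ω => ?_
      · exact ((measurable_expPair u).stronglyMeasurable.integral_kernel
          (κ := hM.kernel h)).measurable.comp (hM.measurable _)
      · have := hM.isProbabilityMeasure_transition h (X ((j : ℝ≥0) * h) ω)
        simpa using norm_integral_le_of_norm_le_const
          (μ := transition P X h (X ((j : ℝ≥0) * h) ω)) (ae_of_all _ (norm_expPair_le hu))
    have hgint : IntegrableOn g (A j) (P x) := hint.sub (hf j).integrableOn
    have h1 : ∫ ω in A j, (f (j + 1) ω - f j ω) ∂(P x) = ∫ ω in A j, g ω ∂(P x) := by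
      have hmar := hM.setIntegral_expPair x (j * h) h (hAF j) hu
      have hj1 : ∀ ω, f (j + 1) ω = expPair u (X (j * h + h) ω) := fun ω => by
        simp only [f, Nat.cast_add, Nat.cast_one, add_mul, one_mul]
      rw [integral_sub (hf (j + 1)).integrableOn (hf j).integrableOn,
        integral_sub hint (hf j).integrableOn]
      congr 1
      simp_rw [hj1]
      exact hmar
    have h2 : ‖∫ ω in A j, (g ω - c) ∂(P x)‖ ≤ η := by
      refine (norm_setIntegral_le_of_norm_le_const (C := η) (measure_lt_top _ _)
        fun ω hω => ?_).trans (mul_le_of_le_one_right hη0 measureReal_le_one)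
      obtain ⟨y, hy, hyX⟩ := hball j ω hω
      simp only [g, f, hyX]
      exact hη y hy
    have h3 : (∫ ω in A j, g ω ∂(P x)) - c =
        (∫ ω in A j, (g ω - c) ∂(P x)) - (P x).real (A j)ᶜ * c := by
      rw [integral_sub hgint (integrable_const _), setIntegral_const, probReal_compl_eq_one_sub (hA j),
        Complex.real_smul]
      push_cast
      ring
    rw [h1, h3]
    refine (norm_sub_le _ _).trans (add_le_add h2 ?_)
    rw [norm_mul, Complex.norm_real, Real.norm_of_nonneg measureReal_nonneg, mul_comm]
    gcongr
    exact hAc j hj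
  calc _ = ‖∑ j ∈ Finset.range N, ((∫ ω in A j, (f (j + 1) ω - f j ω) ∂(P x)) - c)‖ := by
        rw [Finset.sum_sub_distrib, ← hsum]
        simp [K]
    _ ≤ ∑ j ∈ Finset.range N, (η + ‖c‖ * p) :=
        norm_sum_le_of_le _ fun j hj => hstep j (Finset.mem_range.1 hj)
    _ = _ := by rw [Finset.sum_const, Finset.card_range, nsmul_eq_mul]

end Dynkin

/-! ### Differentiability at time zero -/

section Derivative

variable {d : ℕ} {D : Set (EuclideanSpace ℝ (Fin d))}

/-- First-order expansion of `e^{⟨v, y⟩} (e^{a + ⟨b, y⟩} - 1)` in `w = (a, b)`, uniform for `v` and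
`y` close to `u` and `x`. -/
lemma exists_linearization (u : EuclideanSpace ℂ (Fin d)) (x : D) {ε : ℝ} (hε : 0 < ε) :
    ∃ r > 0, ∃ ρ > 0, ∀ᶠ v in 𝓝 u, ∀ w : ℂ × EuclideanSpace ℂ (Fin d), ‖w‖ ≤ ρ →
      ∀ y : D, dist y x ≤ r →
        ‖Complex.exp (pair v y) * (Complex.exp (affineEval w y) - 1) -
          Complex.exp (pair u x) * affineEval w x‖ ≤ ε * ‖w‖ := by
  set M : ℝ := ‖Complex.exp (pair u x)‖ + 1 with hM
  set B : ℝ := 2 + ‖(x : EuclideanSpace ℝ (Fin d))‖ with hB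
  have hMpos : 0 < M := by positivity
  have hBpos : 0 < B := by positivity
  have hcont : Continuous fun p : EuclideanSpace ℂ (Fin d) × D => Complex.exp (pair p.1 p.2) :=
    Complex.continuous_exp.comp
      (continuous_pair.comp (continuous_fst.prodMk (continuous_subtype_val.comp continuous_snd)))
  have hev := Metric.tendsto_nhds.1 (hcont.tendsto (u, x)) (min 1 (ε / (3 * B))) (by positivity)
  rw [nhds_prod_eq] at hev
  obtain ⟨pv, hpv, py, hpy, hp⟩ := eventually_prod_iff.1 hev
  obtain ⟨r₀, hr₀, hball⟩ := Metric.eventually_nhds_iff.1 hpy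
  refine ⟨min (r₀ / 2) (min 1 (ε / (3 * M))), by positivity,
    min (1 / B) (ε / (3 * M * B ^ 2)), by positivity, hpv.mono fun v hv w hw y hy => ?_⟩
  have hy0 : dist y x < r₀ := lt_of_le_of_lt (hy.trans (min_le_left _ _)) (by linarith)
  have hy1 : dist y x ≤ 1 := hy.trans ((min_le_right _ _).trans (min_le_left _ _))
  have hy2 : dist y x ≤ ε / (3 * M) := hy.trans ((min_le_right _ _).trans (min_le_right _ _))
  have hyx : ‖(y : EuclideanSpace ℝ (Fin d)) - x‖ = dist y x := by
    rw [Subtype.dist_eq, dist_eq_norm]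
  have hclose : ‖Complex.exp (pair v y) - Complex.exp (pair u x)‖ < min 1 (ε / (3 * B)) := by
    have := hp hv (hball hy0)
    rwa [dist_eq_norm] at this
  have hvM : ‖Complex.exp (pair v y)‖ ≤ M := by
    have h1 := norm_sub_norm_le (Complex.exp (pair v y)) (Complex.exp (pair u x))
    have h2 := hclose.le.trans (min_le_left _ _)
    linarith
  have hyB : 1 + ‖(y : EuclideanSpace ℝ (Fin d))‖ ≤ B := by
    have := norm_sub_norm_le (y : EuclideanSpace ℝ (Fin d)) x
    linarith
  set a := affineEval w y with ha
  have haB : ‖a‖ ≤ ‖w‖ * B := (norm_affineEval_le w y).trans (by gcongr)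
  have hxB : ‖affineEval w x‖ ≤ ‖w‖ * B :=
    (norm_affineEval_le w x).trans (by gcongr; linarith)
  have hw1 : ‖w‖ * B ≤ 1 := (le_div_iff₀ hBpos).1 (hw.trans (min_le_left _ _))
  have hw2 : ‖w‖ * (3 * M * B ^ 2) ≤ ε := (le_div_iff₀ (by positivity)).1
    (hw.trans (min_le_right _ _))
  have e1 : ‖Complex.exp (pair v y) * (Complex.exp a - 1 - a)‖ ≤ ε / 3 * ‖w‖ := by
    rw [norm_mul]
    calc ‖Complex.exp (pair v y)‖ * ‖Complex.exp a - 1 - a‖ ≤ M * (‖w‖ * B) ^ 2 := by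
          gcongr
          exact (Complex.norm_exp_sub_one_sub_id_le (haB.trans hw1)).trans (by gcongr)
      _ = (‖w‖ * (3 * M * B ^ 2)) / 3 * ‖w‖ := by ring
      _ ≤ ε / 3 * ‖w‖ := by gcongr
  have e2 : ‖Complex.exp (pair v y) * (a - affineEval w x)‖ ≤ ε / 3 * ‖w‖ := by
    rw [norm_mul]
    calc ‖Complex.exp (pair v y)‖ * ‖a - affineEval w x‖ ≤ M * (‖w‖ * (ε / (3 * M))) := by
          gcongr
          refine (norm_affineEval_sub_le w y x).trans ?_
          rw [hyx]
          gcongr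
      _ = ε / 3 * ‖w‖ := by field_simp
  have e3 : ‖(Complex.exp (pair v y) - Complex.exp (pair u x)) * affineEval w x‖ ≤
      ε / 3 * ‖w‖ := by
    rw [norm_mul]
    calc _ ≤ ε / (3 * B) * (‖w‖ * B) := by
          gcongr
          exact hclose.le.trans (min_le_right _ _)
      _ = ε / 3 * ‖w‖ := by field_simp
  calc _ = ‖Complex.exp (pair v y) * (Complex.exp a - 1 - a) +
        Complex.exp (pair v y) * (a - affineEval w x) +
        (Complex.exp (pair v y) - Complex.exp (pair u x)) * affineEval w x‖ := by
          congr 1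
          ring
    _ ≤ ε / 3 * ‖w‖ + ε / 3 * ‖w‖ + ε / 3 * ‖w‖ :=
        norm_add₃_le.trans (add_le_add (add_le_add e1 e2) e3)
    _ = ε * ‖w‖ := by ring

/-- A function with values in a complete space converges along a filter if, up to an arbitrarily
small error relative to its own size, it is eventually constant. -/
lemma exists_tendsto_of_forall_eventually_norm_sub_le {α V : Type*} [NormedAddCommGroup V]
    [CompleteSpace V] {l : Filter α} [l.NeBot] {q : α → V}
    (h : ∀ ε > 0, ∃ Λ, ∀ᶠ p in l, ‖q p - Λ‖ ≤ ε * (‖q p‖ + 1)) : ∃ L, Tendsto q l (𝓝 L) := by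
  obtain ⟨Λ₀, hΛ₀⟩ := h (1 / 2) (by norm_num)
  have hbdd : ∀ᶠ p in l, ‖q p‖ ≤ 2 * ‖Λ₀‖ + 1 := hΛ₀.mono fun p hp => by
    have := norm_sub_norm_le (q p) Λ₀
    linarith
  refine cauchy_map_iff_exists_tendsto.1 (Metric.cauchy_iff.2 ⟨inferInstance, fun ε hε => ?_⟩)
  have hC : 0 < 2 * ‖Λ₀‖ + 2 := by positivity
  obtain ⟨Λ, hΛ⟩ := h (ε / (3 * (2 * ‖Λ₀‖ + 2))) (by positivity)
  refine ⟨Metric.closedBall Λ (ε / 3), ?_, fun a ha b hb => ?_⟩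
  · rw [Filter.mem_map]
    filter_upwards [hbdd, hΛ] with p h1 h2
    rw [Set.mem_preimage, mem_closedBall_iff_norm]
    refine h2.trans ?_
    calc ε / (3 * (2 * ‖Λ₀‖ + 2)) * (‖q p‖ + 1) ≤ ε / (3 * (2 * ‖Λ₀‖ + 2)) * (2 * ‖Λ₀‖ + 2) :=
          mul_le_mul_of_nonneg_left (by linarith) (by positivity)
      _ = ε / 3 := by field_simp
  · rw [Metric.mem_closedBall] at ha hb
    have := dist_triangle_right a b Λ
    linarith

variable {Ω : Type*} [mΩ : MeasurableSpace Ω]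
  {𝔽 : Filtration ℝ≥0 mΩ} {P : OnePoint D → Measure Ω} {X : ℝ≥0 → Ω → OnePoint D}
  {Φ : ℝ≥0 → EuclideanSpace ℂ (Fin d) → ℂ}
  {Ψ : ℝ≥0 → EuclideanSpace ℂ (Fin d) → EuclideanSpace ℂ (Fin d)}
  {φ : ℝ≥0 → EuclideanSpace ℂ (Fin d) → ℂ}
  {ψ : ℝ≥0 → EuclideanSpace ℂ (Fin d) → EuclideanSpace ℂ (Fin d)}

/-- The increment of the exponents `(φ, ψ)` over `[0, t]`. -/
def increment (φ : ℝ≥0 → EuclideanSpace ℂ (Fin d) → ℂ)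
    (ψ : ℝ≥0 → EuclideanSpace ℂ (Fin d) → EuclideanSpace ℂ (Fin d))
    (p : ℝ≥0 × EuclideanSpace ℂ (Fin d)) : ℂ × EuclideanSpace ℂ (Fin d) :=
  (φ p.1 p.2, ψ p.1 p.2 - p.2)

/-- The difference quotient of the exponents `(φ, ψ)` at time `0`. -/
noncomputable def quotient (φ : ℝ≥0 → EuclideanSpace ℂ (Fin d) → ℂ)
    (ψ : ℝ≥0 → EuclideanSpace ℂ (Fin d) → EuclideanSpace ℂ (Fin d))
    (p : ℝ≥0 × EuclideanSpace ℂ (Fin d)) : ℂ × EuclideanSpace ℂ (Fin d) :=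
  ((p.1 : ℝ) : ℂ)⁻¹ • increment φ ψ p

lemma IsNormalized.tendsto_increment (hD : D.Nonempty) (hM : IsMarkovProcess 𝔽 P X)
    (hA : IsAffine P X Φ Ψ) (hN : IsNormalized P X Φ φ ψ)
    (h0 : ∀ u ∈ cU D, φ 0 u = 0 ∧ ψ 0 u = u) {k : ℕ} {u : EuclideanSpace ℂ (Fin d)}
    (hu : u ∈ cUk D k) : Tendsto (increment φ ψ) (𝓝[>] 0 ×ˢ 𝓝[cUk D k] u) (𝓝 0) := by
  have hmem : ((0 : ℝ≥0), u) ∈ cQk D Φ k := ⟨hu, lifetime_pos hD hM hA (cUk_subset_cU k hu)⟩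
  have hc : ContinuousOn (increment φ ψ) (cQk D Φ k) :=
    (hN.continuousOn_phi k).prodMk ((hN.continuousOn_psi k).sub continuousOn_snd)
  have hval : increment φ ψ ((0 : ℝ≥0), u) = 0 := by
    simp [increment, h0 u (cUk_subset_cU k hu)]
  rw [← hval]
  refine (hc _ hmem).tendsto.mono_left (le_inf ?_ ?_)
  · rw [nhds_prod_eq]
    exact Filter.prod_mono nhdsWithin_le_nhds nhdsWithin_le_nhds
  · rw [le_principal_iff]
    exact Filter.prod_mono nhdsWithin_le_nhds le_rfl (eventually_mem_cQk hD hM hA hu)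

/-- The key estimate: the value at `x` of the difference quotient of the exponents is eventually
constant, up to a small error relative to the size of the quotient.  The constant is
`(T e^{⟨u, x⟩})⁻¹ 𝔼^x [e^{⟨u, X_κ⟩} - e^{⟨u, x⟩}]`, where `κ` is the exit time from a small ball,
truncated at a small time `T`. -/
lemma exists_eventually_norm_affineEval_quotient_sub_le (hD : D.Nonempty)
    (hM : IsMarkovProcess 𝔽 P X) (hC : IsCadlag P X)
    (hA : IsAffine P X Φ Ψ) (hN : IsNormalized P X Φ φ ψ)
    (h0 : ∀ u ∈ cU D, φ 0 u = 0 ∧ ψ 0 u = u) {k : ℕ} {u : EuclideanSpace ℂ (Fin d)}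
    (hu : u ∈ cUk D k) (x : D) {ε : ℝ} (hε : 0 < ε) :
    ∃ Λ : ℂ, ∀ᶠ p in 𝓝[>] 0 ×ˢ 𝓝[cUk D k] u,
      ‖affineEval (quotient φ ψ p) x - Λ‖ ≤ ε * (‖quotient φ ψ p‖ + 1) := by
  have := hM.isProbabilityMeasure (x : OnePoint D)
  set e := Complex.exp (pair u x) with he
  have he0 : 0 < ‖e‖ := norm_pos_iff.2 (Complex.exp_ne_zero _)
  set b : ℝ := ‖e‖ * (1 + ‖(x : EuclideanSpace ℝ (Fin d))‖) with hb
  have hb0 : 0 ≤ b := by positivity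
  set m : ℝ := 2 + 3 * b with hm
  have hm0 : 0 < m := by positivity
  set ε₁ : ℝ := ε * ‖e‖ / m with hε₁
  have hε₁0 : 0 < ε₁ := by positivity
  obtain ⟨r, hr, ρ, hρ, hlin⟩ := exists_linearization u x hε₁0
  obtain ⟨T, hT, hexit⟩ := exists_earlyExit_le hM hC x hr hε₁0
  have hT' : (0 : ℝ) < T := hT
  let l : Filter (ℝ≥0 × EuclideanSpace ℂ (Fin d)) := 𝓝[>] 0 ×ˢ 𝓝[cUk D k] u
  -- the expectation at the exit along grids converges
  let E : ℝ≥0 × EuclideanSpace ℂ (Fin d) → ℂ := fun p =>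
    ∫ ω, expPair p.2 (X ((gridIndex (exitSet X x r T ω) p.1 : ℝ≥0) * p.1) ω) ∂(P x)
  let E₀ : ℂ := ∫ ω, expPair u (X (sInf (exitSet X x r T ω)) ω) ∂(P x)
  have hpos : ∀ᶠ p in l, 0 < p.1 := tendsto_fst.eventually eventually_mem_nhdsWithin
  have hUk : ∀ᶠ p in l, p.2 ∈ cUk D k := tendsto_snd.eventually eventually_mem_nhdsWithin
  have hElim : Tendsto E l (𝓝 E₀) := by
    refine tendsto_integral_filter_of_dominated_convergence (fun _ => Real.exp k) ?_ ?_
      (integrable_const _) ?_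
    · exact hpos.mono fun p hp => (measurable_expPair_exit hM x r T hp p.2).aestronglyMeasurable
    · exact hUk.mono fun p hp => ae_of_all _ fun ω => norm_expPair_le hp _
    · exact (ae_isRegularPath hM hC x).mono fun ω hω =>
        hω.tendsto_expPair_exit r T _ nhdsWithin_le_nhds
  have hsnd : Tendsto (fun p : ℝ≥0 × EuclideanSpace ℂ (Fin d) => p.2) l (𝓝 u) :=
    tendsto_snd.mono_right nhdsWithin_le_nhds
  have hdiff : Tendsto (fun p => E p - Complex.exp (pair p.2 x)) l (𝓝 (E₀ - e)) := by
    refine hElim.sub ?_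
    have : Continuous fun v : EuclideanSpace ℂ (Fin d) =>
        Complex.exp (pair v (x : EuclideanSpace ℝ (Fin d))) :=
      Complex.continuous_exp.comp (continuous_pair.comp (continuous_id.prodMk continuous_const))
    exact (this.tendsto u).comp hsnd
  have hfst : ∀ᶠ p in l, (p.1 : ℝ) < min (T : ℝ) (ε₁ * T) := by
    have h1 : Tendsto (fun p : ℝ≥0 × EuclideanSpace ℂ (Fin d) => (p.1 : ℝ)) l (𝓝 0) :=
      (NNReal.tendsto_coe.2 tendsto_id).comp (tendsto_fst.mono_right nhdsWithin_le_nhds)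
    exact h1.eventually (gt_mem_nhds (by positivity))
  refine ⟨(E₀ - e) / (T * e), ?_⟩
  filter_upwards [hpos, hUk, hfst, hsnd.eventually hlin,
    Metric.tendsto_nhds.1 hdiff (ε₁ * T) (by positivity),
    Metric.tendsto_nhds.1 (hN.tendsto_increment hD hM hA h0 hu) ρ hρ,
    Filter.prod_mono nhdsWithin_le_nhds le_rfl (eventually_mem_cQk hD hM hA hu)]
    with p hp hpU hpT hplin hpE hpρ hpQ
  obtain ⟨h, v⟩ := p
  simp only at hp hpU hpT hplin
  have hh : (0 : ℝ) < h := hp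
  set w := increment φ ψ (h, v) with hw
  set q := quotient φ ψ (h, v) with hq
  have hwq : w = ((h : ℝ) : ℂ) • q := by
    rw [hq, quotient, smul_smul, mul_inv_cancel₀ (by exact_mod_cast hh.ne'), one_smul]
  have hwn : ‖w‖ = h * ‖q‖ := by
    rw [hwq, norm_smul, Complex.norm_real, Real.norm_of_nonneg hh.le]
  have hdyn := dynkin_estimate hM hC x r T hp hpU (c := e * affineEval w x) (η := ε₁ * ‖w‖)
    (fun y hy => by
      have hfl : fourierLaplace P X h y v - Complex.exp (pair v y) =
          Complex.exp (pair v y) * (Complex.exp (affineEval w y) - 1) := by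
        rw [hN.eq_exp h v (Set.mem_iUnion.2 ⟨k, hpQ⟩) y, mul_sub, mul_one, ← Complex.exp_add]
        congr 2
        simp only [hw, increment, affineEval, pair_sub_left]
        ring
      rw [hfl]
      rw [dist_zero_right] at hpρ
      exact hplin w hpρ.le y hy) (by positivity)
  set N : ℝ := ((⌈T / h⌉₊ : ℕ) : ℝ) with hNdef
  have hN1 : (T : ℝ) ≤ N * h := by
    have h1 : T / h ≤ ((⌈T / h⌉₊ : ℕ) : ℝ≥0) := Nat.le_ceil _
    have h2 := (div_le_iff₀ hp).1 h1
    exact_mod_cast h2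
  have hN2 : N * h ≤ T + h := by
    have h1 : ((⌈T / h⌉₊ : ℕ) : ℝ≥0) < T / h + 1 := Nat.ceil_lt_add_one zero_le
    have h2 : ((⌈T / h⌉₊ : ℕ) : ℝ≥0) * h ≤ T + h := by
      calc ((⌈T / h⌉₊ : ℕ) : ℝ≥0) * h ≤ (T / h + 1) * h := by gcongr
        _ = T + h := by field_simp
    exact_mod_cast h2
  have hhT : (h : ℝ) ≤ T := hpT.le.trans (min_le_left _ _)
  have hhε : (h : ℝ) ≤ ε₁ * T := hpT.le.trans (min_le_right _ _)
  have hc : ‖e * affineEval q x‖ ≤ b * ‖q‖ := by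
    rw [norm_mul, hb]
    calc _ ≤ ‖e‖ * (‖q‖ * (1 + ‖(x : EuclideanSpace ℝ (Fin d))‖)) := by
          gcongr
          exact norm_affineEval_le _ _
      _ = _ := by ring
  have hcw : e * affineEval w x = (h : ℝ) * (e * affineEval q x) := by
    rw [hwq, affineEval_smul]
    ring
  rw [hcw, hwn] at hdyn
  set g := e * affineEval q x with hg
  have h1 : ‖(E (h, v) - Complex.exp (pair v x)) - (N * h : ℝ) * g‖ ≤
      2 * T * (ε₁ * ‖q‖ * (1 + b)) := by
    have hr1 : ‖((h : ℝ) : ℂ) * g‖ * (P x).real (earlyExit X x r T) ≤ h * (b * ‖q‖) * ε₁ := by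
      rw [norm_mul, Complex.norm_real, Real.norm_of_nonneg hh.le]
      gcongr
    calc _ = ‖E (h, v) - Complex.exp (pair v x) - (⌈T / h⌉₊ : ℕ) * (((h : ℝ) : ℂ) * g)‖ := by
          congr 1
          simp only [hNdef]
          push_cast
          ring
      _ ≤ N * (ε₁ * (h * ‖q‖) + ‖((h : ℝ) : ℂ) * g‖ * (P x).real (earlyExit X x r T)) := hdyn
      _ ≤ N * (ε₁ * (h * ‖q‖) + h * (b * ‖q‖) * ε₁) := by gcongr
      _ = (N * h) * (ε₁ * ‖q‖ * (1 + b)) := by ring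
      _ ≤ 2 * T * (ε₁ * ‖q‖ * (1 + b)) :=
          mul_le_mul_of_nonneg_right (by linarith) (by positivity)
  have h2 : ‖((N * h - T : ℝ) : ℂ) * g‖ ≤ ε₁ * T * (b * ‖q‖) := by
    rw [norm_mul, Complex.norm_real, Real.norm_of_nonneg (by linarith)]
    gcongr
    linarith
  rw [dist_eq_norm] at hpE
  have h3 : ‖(T : ℂ) * g - (E₀ - e)‖ ≤ ε₁ * T * (m * (‖q‖ + 1)) := by
    have hsplit : (T : ℂ) * g - (E₀ - e) =
        (E (h, v) - Complex.exp (pair v x) - (E₀ - e)) -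
        ((E (h, v) - Complex.exp (pair v x)) - (N * h : ℝ) * g) - ((N * h - T : ℝ) : ℂ) * g := by
      push_cast
      ring
    rw [hsplit]
    refine (norm_sub_le _ _).trans ((add_le_add (norm_sub_le _ _) le_rfl).trans ?_)
    have hTm : ε₁ * T * 1 ≤ ε₁ * T * m := by
      gcongr
      linarith
    calc _ ≤ ε₁ * T + 2 * T * (ε₁ * ‖q‖ * (1 + b)) + ε₁ * T * (b * ‖q‖) := by
          gcongr
      _ = ε₁ * T * 1 + ε₁ * T * (m * ‖q‖) := by
          rw [hm]
          ring
      _ ≤ ε₁ * T * m + ε₁ * T * (m * ‖q‖) := by gcongr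
      _ = _ := by ring
  have hTe : ((T : ℝ) : ℂ) * e ≠ 0 :=
    mul_ne_zero (by exact_mod_cast hT'.ne') (Complex.exp_ne_zero _)
  have h4 : affineEval q x - (E₀ - e) / (T * e) = ((T : ℂ) * g - (E₀ - e)) / (T * e) := by
    rw [eq_div_iff hTe, sub_mul, div_mul_cancel₀ _ hTe, hg]
    ring
  rw [h4, norm_div, div_le_iff₀ (norm_pos_iff.2 hTe), norm_mul]
  refine h3.trans (le_of_eq ?_)
  have : ‖((T : ℝ) : ℂ)‖ = T := by
    rw [Complex.norm_real, Real.norm_of_nonneg hT'.le]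
  rw [this, hε₁]
  field_simp

lemma IsNormalized.exists_tendsto_quotient (hD_nonempty : D.Nonempty) (hD : affineSpan ℝ D = ⊤)
    (hM : IsMarkovProcess 𝔽 P X) (hC : IsCadlag P X)
    (hA : IsAffine P X Φ Ψ) (hN : IsNormalized P X Φ φ ψ)
    (h0 : ∀ u ∈ cU D, φ 0 u = 0 ∧ ψ 0 u = u) {k : ℕ} {u : EuclideanSpace ℂ (Fin d)}
    (hu : u ∈ cUk D k) :
    ∃ L, Tendsto (quotient φ ψ) (𝓝[>] 0 ×ˢ 𝓝[cUk D k] u) (𝓝 L) := by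
  obtain ⟨ι, _, p, c, L, hL, -⟩ := exists_interpolation hD
  have : (𝓝[cUk D k] u).NeBot := mem_closure_iff_nhdsWithin_neBot.1 (subset_closure hu)
  refine exists_tendsto_of_forall_eventually_norm_sub_le fun ε hε => ?_
  have hδ : 0 < ε / (‖L‖ + 1) := by positivity
  choose Λ hΛ using fun i => exists_eventually_norm_affineEval_quotient_sub_le hD_nonempty hM hC
    hA hN h0 hu (p i) hδ
  refine ⟨L Λ, (eventually_all.2 hΛ).mono fun z hz => ?_⟩
  have h1 : quotient φ ψ z - L Λ = L ((fun i => affineEval (quotient φ ψ z) (p i)) - Λ) := by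
    rw [map_sub, hL]
  rw [h1]
  calc _ ≤ ‖L‖ * ‖(fun i => affineEval (quotient φ ψ z) (p i)) - Λ‖ := L.le_opNorm _
    _ ≤ ‖L‖ * (ε / (‖L‖ + 1) * (‖quotient φ ψ z‖ + 1)) := by
        gcongr
        exact (pi_norm_le_iff_of_nonneg (by positivity)).2 hz
    _ ≤ (‖L‖ + 1) * (ε / (‖L‖ + 1) * (‖quotient φ ψ z‖ + 1)) := by
        gcongr
        linarith
    _ = ε * (‖quotient φ ψ z‖ + 1) := by field_simp

lemma tendsto_quotient_left {k : ℕ} {u : EuclideanSpace ℂ (Fin d)} (hu : u ∈ cUk D k)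
    {L : ℂ × EuclideanSpace ℂ (Fin d)}
    (h : Tendsto (quotient φ ψ) (𝓝[>] 0 ×ˢ 𝓝[cUk D k] u) (𝓝 L)) :
    Tendsto (fun t => quotient φ ψ (t, u)) (𝓝[>] 0) (𝓝 L) :=
  h.comp (tendsto_id.prodMk (tendsto_nhdsWithin_iff.2
    ⟨tendsto_const_nhds, Eventually.of_forall fun _ => hu⟩))

lemma hasRightDerivAtZero_of_tendsto {V : Type*} [NormedAddCommGroup V] [NormedSpace ℝ V]
    {f : ℝ≥0 → V} {f' : V}
    (h : Tendsto (fun t : ℝ≥0 => (t : ℝ)⁻¹ • (f t - f 0)) (𝓝[>] 0) (𝓝 f')) :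
    HasRightDerivAtZero f f' := by
  rw [HasRightDerivAtZero, hasDerivWithinAt_iff_tendsto_slope, Set.Ici_sdiff_left]
  have hto : Tendsto Real.toNNReal (𝓝[>] (0 : ℝ)) (𝓝[>] (0 : ℝ≥0)) := by
    refine tendsto_nhdsWithin_iff.2 ⟨?_, eventually_mem_nhdsWithin.mono fun t ht =>
      Real.toNNReal_pos.2 ht⟩
    have := (continuous_real_toNNReal.tendsto 0).mono_left (nhdsWithin_le_nhds (s := Set.Ioi 0))
    rwa [Real.toNNReal_zero] at this
  refine (h.comp hto).congr' (eventually_mem_nhdsWithin.mono fun t ht => ?_)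
  simp [slope_def_module, Real.coe_toNNReal t (le_of_lt ht)]

/-- Affine processes are regular.  `F` and `R` are the components of the limit of the difference
quotients; as this limit is joint in time and in the transform variable, it is continuous. -/
lemma isRegular (hD_nonempty : D.Nonempty) (hD : affineSpan ℝ D = ⊤)
    (hM : IsMarkovProcess 𝔽 P X) (hC : IsCadlag P X) (hA : IsAffine P X Φ Ψ) :
    IsRegular P X Φ := by
  obtain ⟨φ, ψ, hN, h0⟩ := exists_normalized hD_nonempty hD hM hA
  refine ⟨fun u hu => lifetime_pos hD_nonempty hM hA hu, φ, ψ, hN,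
    fun φ₁ ψ₁ hN₁ t u htu => hN.unique hD_nonempty hD hM hA hN₁ htu, ?_⟩
  have hlim : ∀ k, ∀ u ∈ cUk D k,
      ∃ L, Tendsto (quotient φ ψ) (𝓝[>] 0 ×ˢ 𝓝[cUk D k] u) (𝓝 L) := fun k u hu =>
    hN.exists_tendsto_quotient hD_nonempty hD hM hC hA h0 hu
  have hlimit : ∀ u, ∃ L, u ∈ cU D → ∀ k, u ∈ cUk D k →
      Tendsto (quotient φ ψ) (𝓝[>] 0 ×ˢ 𝓝[cUk D k] u) (𝓝 L) := by
    intro u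
    by_cases hu : u ∈ cU D
    · obtain ⟨k, hk⟩ := exists_mem_cUk hu
      obtain ⟨L, hL⟩ := hlim k u hk
      refine ⟨L, fun _ m hm => ?_⟩
      obtain ⟨L', hL'⟩ := hlim m u hm
      rwa [tendsto_nhds_unique (tendsto_quotient_left hk hL) (tendsto_quotient_left hm hL')]
    · exact ⟨0, fun h => absurd h hu⟩
  choose G hG using hlimit
  have hGt : ∀ u ∈ cU D, Tendsto (fun t => quotient φ ψ (t, u)) (𝓝[>] 0) (𝓝 (G u)) := by
    intro u hu
    obtain ⟨k, hk⟩ := exists_mem_cUk hu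
    exact tendsto_quotient_left hk (hG u hu k hk)
  have hGc : ∀ k, ContinuousOn G (cUk D k) := by
    intro k u hu
    refine (closed_nhds_basis (G u)).tendsto_right_iff.2 fun C ⟨hC, hCcl⟩ => ?_
    obtain ⟨p, hp, q, hq, hpq⟩ := eventually_prod_iff.1
      ((hG u (cUk_subset_cU k hu) k hu).eventually_mem hC)
    filter_upwards [hq, eventually_mem_nhdsWithin] with v hv hvU
    exact hCcl.mem_of_tendsto (hGt v (cUk_subset_cU k hvU)) (hp.mono fun t ht => hpq ht hv)
  refine ⟨fun u => (G u).1, fun u => (G u).2, fun u hu => ⟨?_, ?_⟩,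
    fun k => ⟨(hGc k).fst, (hGc k).snd⟩⟩
  · refine hasRightDerivAtZero_of_tendsto (((continuous_fst.tendsto _).comp (hGt u hu)).congr
      fun t => ?_)
    simp [quotient, increment, h0 u hu]
  · refine hasRightDerivAtZero_of_tendsto (((continuous_snd.tendsto _).comp (hGt u hu)).congr
      fun t => ?_)
    ext i
    simp [quotient, increment, h0 u hu]

end Derivative

end AffineProcess

theorem theorem3 {d : ℕ} {D : Set (EuclideanSpace ℝ (Fin d))}
    (hD_nonempty : D.Nonempty) (hD_borel : MeasurableSet D) (hD_span : affineSpan ℝ D = ⊤)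
    {Ω : Type*} [mΩ : MeasurableSpace Ω] (𝔽 : Filtration ℝ≥0 mΩ) [𝔽.IsRightContinuous]
    (P : OnePoint D → Measure Ω) (X : ℝ≥0 → Ω → OnePoint D)
    (hX_markov : AffineProcess.IsMarkovProcess 𝔽 P X)
    (hX_cadlag : AffineProcess.IsCadlag P X)
    (Φ : ℝ≥0 → EuclideanSpace ℂ (Fin d) → ℂ)
    (ψ : ℝ≥0 → EuclideanSpace ℂ (Fin d) → EuclideanSpace ℂ (Fin d))
    (hX_affine : AffineProcess.IsAffine P X Φ ψ) :
    AffineProcess.IsRegular P X Φ :=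
  AffineProcess.isRegular hD_nonempty hD_span hX_markov hX_cadlag hX_affine
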